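/- **Definitions.** Let $\mathcal C$ be an abelian category. A *complete $\mathcal C$-projective resolution* is an exact complex $P^\bullet=(P^n,d^n:P^n\to P^{n+1})_{n\in\mathbb Z}$ of projective objects of $\mathcal C$ such that $\operatorname{Hom}_{\mathcal C}(P^\bullet,Q)$ is exact for every projective object $Q$. An object is *Gorenstein projective* if it is isomorphic to $\operatorname{Im}(d^0)$ for some complete $\mathcal C$-projective resolution. A *cleft extension* $(\mathcal B,\mathcal A,e,i,l)$ consists of abelian categories $\mathcal A,\mathcal B$ and functors $e:\mathcal A\to\mathcal B$, $i,l:\mathcal B\to\mathcal A$ such that $e$ is faithful and exact, $l$ is left adjoint to $e$, and $ei\cong\mathrm{Id}_{\mathcal B}$. Then $i$ has a left adjoint $q:\mathcal A\to\mathcal B$, and $ql\cong\mathrm{Id}_{\mathcal B}$. Let $\lambda:le\to\mathrm{Id}_{\mathcal A}$ be the counit, let $u:G\to le$ be the kernel of $\lambda$, and put $F=eGi:\mathcal B\to\mathcal B$. Applying $e$ to $0\to Gi\to lei\to i\to 0$ and using $ei\cong\mathrm{Id}_{\mathcal B}$ gives an exact sequence $0\to F\xrightarrow{\nu}el\to\mathrm{Id}_{\mathcal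 B}\to 0$, which is split by the unit $\mathrm{Id}_{\mathcal B}\to el$; let $\nu':el\to F$ be the retraction of $\nu$ that vanishes on the unit. For $X\in\mathcal A$, both $eG(X)$ and $Fe(X)$ are complements of the image of the unit $e(X)\to ele(X)$, which gives a natural isomorphism $eG\cong Fe$ and hence $eG^2\cong F^2e$. Through these isomorphisms and $ql\cong\mathrm{Id}_{\mathcal B}$, let $$\alpha_X:F^2e(X)\to Fe(X)\quad\text{and}\quad \beta_X:Fe(X)\to e(X)$$ be the morphisms corresponding to $q(u_{G(X)})\circ q(\lambda_{G^2(X)}):qleG^2(X)\to qleG(X)$ and $q(u_X)\circ q(\lambda_{G(X)}):qleG(X)\to qle(X)$ respectively. Let $\eta:F^2\to F$ be the natural transformation with components $$F^2(Y)\xrightarrow{\nu_{F(Y)}}elF(Y)\xrightarrow{el(\nu_Y)}elel(Y)\xrightarrow{e(\lambda_{l(Y)})}el(Y)\xrightarrow{\nu'_Y}F(Y)\qquad(Y\in\mathcal B).$$ The cleft extension is *compatible* if the following two conditions hold. (a) For every complete $\mathcal B$-projective resolution $P^\bullet$ and every projective $P'\in\mathcal B$, the complexes $F(P^\bullet)$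 and $\operatorname{Hom}_{\mathcal B}(P^\bullet,F(P'))$ are acyclic. (b) At least one of the following holds: * (b1) for every complete $\mathcal A$-projective resolution $Q^\bullet$ and every projective $P\in\mathcal B$, the complexes $q(Q^\bullet)$ and $\operatorname{Hom}_{\mathcal A}(Q^\bullet,i(P))$ are acyclic; * (b2) $F^s=0$ for some $s$; $\mathcal B$ has projective resolutions and $\mathbb L_k(F^j)(F(P))=0$ for all $k,j>0$ and all projective $P\in\mathcal B$; and for every complete $\mathcal A$-projective resolution $Q^\bullet$, every $j>0$ and every projective $P\in\mathcal B$, the complexes $F^j(e(Q^\bullet))$ and $\operatorname{Hom}_{\mathcal A}(Q^\bullet,lF^j(P))$ are acyclic. **Theorem.** Let $(\mathcal B,\mathcal A,e,i,l)$ be a compatible cleft extension and let $X\in\mathcal A$. Consider the following conditions: 1. $X$ is Gorenstein projective in $\mathcal A$; 2. $q(X)$ is Gorenstein projective in $\mathcal B$ and $q(u_X):qG(X)\to qle(X)$ is a monomorphism; 3. $q(X)$ is Gorenstein projective in $\mathcal B$ and the sequence $F^2e(X)\xrightarrow{\alpha_X}Fe(X)\xrightarrow{\beta_X}e(X)$ is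 exact. Then (1) $\Rightarrow$ (2) $\Leftrightarrow$ (3). Moreover, if $\eta=0$, then all three conditions are equivalent. -/

import Mathlib

open CategoryTheory CategoryTheory.Limits

universe v₁ v₂ u₁ u₂

noncomputable section

namespace CleftExt

section Gorenstein

variable {C : Type u₁} [Category.{v₁} C] [Abelian C]

/-- The complex of abelian groups `Hom(P, M)` is acyclic: every cocycle (a morphism `P n ⟶ M`
killed by the incoming differential) is a coboundary (it extends along the outgoing one). -/
def HomAcyclic (P : CochainComplex C ℤ) (M : C) : Prop :=
  ∀ (n : ℤ) (f : P.X n ⟶ M), P.d (n - 1) n ≫ f = 0 →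
    ∃ g : P.X (n + 1) ⟶ M, P.d n (n + 1) ≫ g = f

/-- A complete projective resolution: an exact unbounded complex of projective objects that stays
exact under `Hom(-, Q)` for every projective object `Q`. -/
structure IsCompleteProjectiveResolution (P : CochainComplex C ℤ) : Prop where
  acyclic : P.Acyclic
  projective : ∀ n : ℤ, Projective (P.X n)
  hom_acyclic : ∀ Q : C, Projective Q → HomAcyclic P Q

/-- `X` is Gorenstein projective: it is the image of the differential in degree `0` of some
complete projective resolution. -/
def IsGorensteinProjective (X : C) : Prop :=
  ∃ P : CochainComplex C ℤ, IsCompleteProjectiveResolution P ∧ Nonempty (X ≅ image (P.d 0 1))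

/-- The `n`-th iterate of an endofunctor. -/
def iter (F : C ⥤ C) : ℕ → (C ⥤ C)
  | 0 => 𝟭 C
  | n + 1 => iter F n ⋙ F

instance iter_additive (F : C ⥤ C) [F.Additive] : ∀ n : ℕ, (iter F n).Additive
  | 0 => inferInstanceAs (𝟭 C).Additive
  | n + 1 =>
    haveI := iter_additive F n
    inferInstanceAs (iter F n ⋙ F).Additive

/-- Some iterate of the endofunctor is zero. -/
def IsNilpotent (F : C ⥤ C) : Prop := ∃ n : ℕ, ∀ Y : C, IsZero ((iter F n).obj Y)

end Gorenstein

end CleftExt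

/-- A cleft extension `(B, A, e, i, l)` of the abelian category `B`: functors `e : A ⥤ B` and
`i, l : B ⥤ A` such that `e` is faithful and exact, `l` is left adjoint to `e`, and `e ∘ i` is
naturally isomorphic to the identity. -/
structure CleftExtension (B : Type u₁) [Category.{v₁} B] [Abelian B]
    (A : Type u₂) [Category.{v₂} A] [Abelian A] where
  e : A ⥤ B
  i : B ⥤ A
  l : B ⥤ A
  faithful : e.Faithful
  leftExact : PreservesFiniteLimits e
  rightExact : PreservesFiniteColimits e
  adj : l ⊣ e
  ei : i ⋙ e ≅ 𝟭 B

namespace CleftExtension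

open CleftExt

variable {B : Type u₁} [Category.{v₁} B] [Abelian B] {A : Type u₂} [Category.{v₂} A] [Abelian A]
variable (E : CleftExtension B A)

instance : E.e.Faithful := E.faithful
instance : PreservesFiniteLimits E.e := E.leftExact
instance : PreservesFiniteColimits E.e := E.rightExact
instance : E.e.Additive := Functor.additive_of_preserves_binary_products _
instance : E.l.Additive := E.adj.left_adjoint_additive

/-- Since `ei ≅ Id`, the identity functor is left adjoint to `ei`. -/
def idAdj : 𝟭 B ⊣ E.i ⋙ E.e := Adjunction.id.ofNatIsoRight E.ei.symm

instance : (E.i ⋙ E.e).IsRightAdjoint := E.idAdj.isRightAdjoint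

/-- The functor `i` has a left adjoint. -/
instance : E.i.IsRightAdjoint :=
  isRightAdjoint_triangle_lift E.i E.adj fun X =>
    haveI : Epi (E.adj.counit.app X) := inferInstance
    haveI : NormalEpi (E.adj.counit.app X) := (normalEpiOfEpi _)
    NormalEpi.regularEpi _

/-- The functor `q : A ⥤ B`, left adjoint to `i`. -/
def q : A ⥤ B := E.i.leftAdjoint

/-- The adjunction `q ⊣ i`. -/
def qAdj : E.q ⊣ E.i := Adjunction.ofIsRightAdjoint E.i

instance : E.q.IsLeftAdjoint := E.qAdj.isLeftAdjoint
instance : E.i.Additive where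
  map_add {X Y f g} := E.e.map_injective (by
    have h (k : X ⟶ Y) := E.ei.hom.naturality k
    dsimp at h
    rw [E.e.map_add, ← cancel_mono (E.ei.hom.app Y), Preadditive.add_comp, h, h, h]
    simp)
instance : E.q.Additive := E.qAdj.left_adjoint_additive

/-- The isomorphism `ql ≅ Id` obtained from `ql ⊣ ei` and `ei ≅ Id`. -/
def qlIso : E.l ⋙ E.q ≅ 𝟭 B := (E.adj.comp E.qAdj).leftAdjointUniq E.idAdj

/-- The endofunctor `G` of `A`, the kernel of the counit `le ⟶ Id`. -/
def G : A ⥤ A where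
  obj X := kernel (E.adj.counit.app X)
  map {X Y} f := kernel.map (E.adj.counit.app X) (E.adj.counit.app Y) (E.l.map (E.e.map f)) f
    (E.adj.counit.naturality f).symm

/-- The inclusion `u : G ⟶ le`. -/
def u : E.G ⟶ E.e ⋙ E.l where
  app X := kernel.ι (E.adj.counit.app X)
  naturality _ _ _ := kernel.lift_ι _ _ _

/-- The endofunctor `F = eGi` of `B`. -/
def F : B ⥤ B := E.i ⋙ E.G ⋙ E.e

/-- The inclusion `ν : F ⟶ el`, which is `e(u i) : eGi ⟶ elei` followed by `elei ≅ el`. -/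
def nu : E.F ⟶ E.l ⋙ E.e where
  app Y := E.e.map (E.u.app (E.i.obj Y)) ≫ E.e.map (E.l.map (E.ei.hom.app Y))
  naturality X Y f := by
    have h1 := E.u.naturality (E.i.map f)
    have h2 := E.ei.hom.naturality f
    dsimp [F] at h1 h2 ⊢
    simp only [← Functor.map_comp, Category.assoc, reassoc_of% h1, h2]

/-- The projection `el ⟶ Id`, the cokernel of `ν`: it is `e(λ i) : elei ⟶ ei` up to `ei ≅ Id`. -/
def proj : E.l ⋙ E.e ⟶ 𝟭 B where
  app Y := E.e.map (E.l.map (E.ei.inv.app Y)) ≫ E.e.map (E.adj.counit.app (E.i.obj Y)) ≫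
    E.ei.hom.app Y
  naturality X Y f := by
    have h1 := E.ei.inv.naturality f
    have h2 := E.adj.counit.naturality (E.i.map f)
    have h3 := E.ei.hom.naturality f
    dsimp at h1 h2 h3 ⊢
    simp only [Category.assoc, ← h3, ← Functor.map_comp_assoc, h1, ← h2]

lemma u_counit (X : A) : E.u.app X ≫ E.adj.counit.app X = 0 := kernel.condition _

instance (X : A) : Mono (E.u.app X) := inferInstanceAs (Mono (kernel.ι _))

/-- The retraction `ele ⟶ eG` of `e(u)` whose kernel is the image of the unit `e ⟶ ele`. -/
def retr (X : A) : E.e.obj (E.l.obj (E.e.obj X)) ⟶ E.e.obj (E.G.obj X) :=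
  kernel.lift (E.e.map (E.adj.counit.app X))
    (𝟙 _ - E.e.map (E.adj.counit.app X) ≫ E.adj.unit.app (E.e.obj X)) (by
      simp [Preadditive.sub_comp]) ≫ (PreservesKernel.iso E.e (E.adj.counit.app X)).inv

lemma retr_u (X : A) : E.retr X ≫ E.e.map (E.u.app X) =
    𝟙 _ - E.e.map (E.adj.counit.app X) ≫ E.adj.unit.app (E.e.obj X) := by
  change (_ ≫ (PreservesKernel.iso E.e (E.adj.counit.app X)).inv) ≫
    E.e.map (kernel.ι (E.adj.counit.app X)) = _
  rw [Category.assoc, PreservesKernel.iso_inv_ι, kernel.lift_ι]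

lemma u_retr (X : A) : E.e.map (E.u.app X) ≫ E.retr X = 𝟙 _ := by
  rw [← cancel_mono (E.e.map (E.u.app X)), Category.assoc, retr_u, Preadditive.comp_sub,
    ← Functor.map_comp_assoc, u_counit]
  simp

lemma unit_retr (X : A) : E.adj.unit.app (E.e.obj X) ≫ E.retr X = 0 := by
  rw [← cancel_mono (E.e.map (E.u.app X)), Category.assoc, retr_u, Preadditive.comp_sub]
  simp

lemma retr_naturality {X Y : A} (f : X ⟶ Y) :
    E.e.map (E.l.map (E.e.map f)) ≫ E.retr Y = E.retr X ≫ E.e.map (E.G.map f) := by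
  have h1 := congrArg E.e.map (E.u.naturality f)
  have h2 := congrArg E.e.map (E.adj.counit.naturality f)
  have h3 := E.adj.unit.naturality (E.e.map f)
  dsimp at h1 h2 h3
  rw [Functor.map_comp, Functor.map_comp] at h1 h2
  rw [← cancel_mono (E.e.map (E.u.app Y)), Category.assoc, Category.assoc, retr_u,
    h1, reassoc_of% (E.retr_u X), Preadditive.comp_sub, Preadditive.sub_comp, reassoc_of% h2,
    Category.assoc, h3]
  dsimp
  rw [Category.comp_id, Category.id_comp]

lemma el_hom_inv (Y : B) :
    E.e.map (E.l.map (E.ei.hom.app Y)) ≫ E.e.map (E.l.map (E.ei.inv.app Y)) = 𝟙 _ := by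
  rw [← Functor.map_comp, ← Functor.map_comp, Iso.hom_inv_id_app]
  simp

lemma el_inv_hom (Y : B) :
    E.e.map (E.l.map (E.ei.inv.app Y)) ≫ E.e.map (E.l.map (E.ei.hom.app Y)) = 𝟙 _ := by
  rw [← Functor.map_comp, ← Functor.map_comp, Iso.inv_hom_id_app]
  simp

/-- The projection `ν' : el ⟶ F` of the splitting: it is a retraction of `ν` and it vanishes on the
section `Id ⟶ el` (the unit) of `el ⟶ Id`. -/
def nu' : E.l ⋙ E.e ⟶ E.F where
  app Y := E.e.map (E.l.map (E.ei.inv.app Y)) ≫ E.retr (E.i.obj Y)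
  naturality X Y f := by
    have h1 := congrArg (fun k => E.e.map (E.l.map k)) (E.ei.inv.naturality f)
    have h2 := E.retr_naturality (E.i.map f)
    dsimp [F] at h1 h2 ⊢
    simp only [Functor.map_comp] at h1
    rw [Category.assoc, ← h2, reassoc_of% h1]

lemma nu_nu' (Y : B) : E.nu.app Y ≫ E.nu'.app Y = 𝟙 (E.F.obj Y) := by
  change (E.e.map (E.u.app (E.i.obj Y)) ≫ E.e.map (E.l.map (E.ei.hom.app Y))) ≫
    E.e.map (E.l.map (E.ei.inv.app Y)) ≫ E.retr (E.i.obj Y) = 𝟙 (E.e.obj (E.G.obj (E.i.obj Y)))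
  rw [Category.assoc, reassoc_of% (E.el_hom_inv Y), u_retr]

lemma nu_proj (Y : B) : E.nu.app Y ≫ E.proj.app Y = 0 := by
  change (E.e.map (E.u.app (E.i.obj Y)) ≫ E.e.map (E.l.map (E.ei.hom.app Y))) ≫
    E.e.map (E.l.map (E.ei.inv.app Y)) ≫ E.e.map (E.adj.counit.app (E.i.obj Y)) ≫
      E.ei.hom.app Y = 0
  rw [Category.assoc, reassoc_of% (E.el_hom_inv Y), ← Functor.map_comp_assoc, u_counit]
  simp

lemma unit_proj (Y : B) : E.adj.unit.app Y ≫ E.proj.app Y = 𝟙 Y := by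
  have h := E.adj.unit.naturality (E.ei.inv.app Y)
  dsimp at h
  simp [proj, ← reassoc_of% h]

lemma unit_nu' (Y : B) : E.adj.unit.app Y ≫ E.nu'.app Y = 0 := by
  have h := E.adj.unit.naturality (E.ei.inv.app Y)
  dsimp at h
  change E.adj.unit.app Y ≫ E.e.map (E.l.map (E.ei.inv.app Y)) ≫ E.retr (E.i.obj Y) = 0
  rw [← reassoc_of% h, unit_retr, comp_zero]

lemma nu'_nu (Y : B) :
    E.nu'.app Y ≫ E.nu.app Y = 𝟙 _ - E.proj.app Y ≫ E.adj.unit.app Y := by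
  let t : (𝟭 B).obj Y ⟶ E.e.obj (E.l.obj ((𝟭 B).obj Y)) := E.adj.unit.app Y
  have h : E.ei.hom.app Y ≫ t =
      E.adj.unit.app (E.e.obj (E.i.obj Y)) ≫ E.e.map (E.l.map (E.ei.hom.app Y)) :=
    E.adj.unit.naturality (E.ei.hom.app Y)
  change (E.e.map (E.l.map (E.ei.inv.app Y)) ≫ E.retr (E.i.obj Y)) ≫
    E.e.map (E.u.app (E.i.obj Y)) ≫ E.e.map (E.l.map (E.ei.hom.app Y)) =
    𝟙 (E.e.obj (E.l.obj ((𝟭 B).obj Y))) - (E.e.map (E.l.map (E.ei.inv.app Y)) ≫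
      E.e.map (E.adj.counit.app (E.i.obj Y)) ≫ E.ei.hom.app Y) ≫ t
  rw [Category.assoc, reassoc_of% (E.retr_u (E.i.obj Y)), Preadditive.sub_comp,
    Preadditive.comp_sub, Category.assoc, Category.assoc, Category.assoc, ← h]
  have h' := E.el_inv_hom Y
  erw [Category.id_comp]
  rw [h']

/-- The isomorphism `eG ≅ Fe`; both sides are complements of the unit `e ⟶ ele` in `ele`. -/
def eGIso (X : A) : E.e.obj (E.G.obj X) ≅ E.F.obj (E.e.obj X) where
  hom := E.e.map (E.u.app X) ≫ E.nu'.app (E.e.obj X)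
  inv := E.nu.app (E.e.obj X) ≫ E.retr X
  hom_inv_id := by
    have h := E.unit_retr X
    rw [Category.assoc, reassoc_of% (E.nu'_nu (E.e.obj X)), Preadditive.sub_comp,
      Preadditive.comp_sub, Category.assoc, h]
    simpa using E.u_retr X
  inv_hom_id := by
    have h := E.unit_nu' (E.e.obj X)
    rw [Category.assoc, reassoc_of% (E.retr_u X), Preadditive.sub_comp, Preadditive.comp_sub,
      Category.assoc, h]
    simpa using E.nu_nu' (E.e.obj X)

/-- The morphism `β_X : Fe(X) ⟶ e(X)`, which is `q(λ_{GX}) : qleG(X) ⟶ qG(X)` followed by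
`q(u_X) : qG(X) ⟶ qle(X)`, read through `ql ≅ Id` and `eG ≅ Fe`. -/
def beta (X : A) : E.F.obj (E.e.obj X) ⟶ E.e.obj X :=
  (E.eGIso X).inv ≫ E.qlIso.inv.app (E.e.obj (E.G.obj X)) ≫
    E.q.map (E.adj.counit.app (E.G.obj X)) ≫ E.q.map (E.u.app X) ≫
      E.qlIso.hom.app (E.e.obj X)

/-- The morphism `α_X : F²e(X) ⟶ Fe(X)`, which is `q(λ_{G²X}) : qleG²(X) ⟶ qG²(X)` followed by
`q(u_{GX}) : qG²(X) ⟶ qleG(X)`, read through `ql ≅ Id`, `eG ≅ Fe` and `eG² ≅ FeG ≅ F²e`. -/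
def alpha (X : A) : E.F.obj (E.F.obj (E.e.obj X)) ⟶ E.F.obj (E.e.obj X) :=
  E.F.map (E.eGIso X).inv ≫ (E.eGIso (E.G.obj X)).inv ≫
    E.qlIso.inv.app (E.e.obj (E.G.obj (E.G.obj X))) ≫
      E.q.map (E.adj.counit.app (E.G.obj (E.G.obj X))) ≫ E.q.map (E.u.app (E.G.obj X)) ≫
        E.qlIso.hom.app (E.e.obj (E.G.obj X)) ≫ (E.eGIso X).hom

lemma alpha_beta (X : A) : E.alpha X ≫ E.beta X = 0 := by
  have h : E.q.map (E.u.app (E.G.obj X)) ≫ E.q.map (E.adj.counit.app (E.G.obj X)) = 0 := by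
    rw [← Functor.map_comp, u_counit, Functor.map_zero]
  simp only [alpha, beta, Category.assoc, Iso.hom_inv_id_assoc, Iso.hom_inv_id_app_assoc]
  simp [reassoc_of% h]

/-- The natural transformation `η : F² ⟶ F`, with components
`F²(Y) ⟶ elF(Y) ⟶ elel(Y) ⟶ el(Y) ⟶ F(Y)`. -/
def eta : E.F ⋙ E.F ⟶ E.F where
  app Y := E.nu.app (E.F.obj Y) ≫ E.e.map (E.l.map (E.nu.app Y)) ≫
    E.e.map (E.adj.counit.app (E.l.obj Y)) ≫ E.nu'.app Y
  naturality X Y f := by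
    have h1 := E.nu.naturality (E.F.map f)
    have h2 := E.nu.naturality f
    have h3 := E.adj.counit.naturality (E.l.map f)
    have h4 := E.nu'.naturality f
    dsimp at h1 h2 h3 h4 ⊢
    simp only [Category.assoc, reassoc_of% h1, ← h4, ← Functor.map_comp_assoc, h2, ← h3]

instance : E.G.Additive where
  map_add {X Y f g} := by
    have h (k : X ⟶ Y) := E.u.naturality k
    dsimp at h
    rw [← cancel_mono (E.u.app Y), Preadditive.add_comp, h, h, h]
    simp
instance : E.F.Additive := inferInstanceAs (E.i ⋙ E.G ⋙ E.e).Additive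

/-- The compatibility condition concerning `l`: for every complete `B`-projective resolution `P`
and every projective `P'` of `B`, the complexes `F(P)` and `Hom(P, F(P'))` are acyclic. -/
def CompatibleL : Prop :=
  ∀ P : CochainComplex B ℤ, IsCompleteProjectiveResolution P →
    ((E.F.mapHomologicalComplex _).obj P).Acyclic ∧
      ∀ P' : B, Projective P' → HomAcyclic P (E.F.obj P')

/-- The first form of the compatibility condition concerning `q`: for every complete
`A`-projective resolution `Q` and every projective `P` of `B`, the complexes `q(Q)` and
`Hom(Q, i(P))` are acyclic. -/
def CompatibleQ : Prop :=
  ∀ Q : CochainComplex A ℤ, IsCompleteProjectiveResolution Q →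
    ((E.q.mapHomologicalComplex _).obj Q).Acyclic ∧
      ∀ P : B, Projective P → HomAcyclic Q (E.i.obj P)

/-- The second form of the compatibility condition concerning `q`: `F` is nilpotent, the left
derived functors `𝕃ₖ(Fʲ)` vanish on `F(P)` for `k, j > 0` and `P` projective, and for every complete
`A`-projective resolution `Q`, every `j > 0` and every projective `P` of `B` the complexes
`Fʲ(e(Q))` and `Hom(Q, l(Fʲ(P)))` are acyclic. That the left derived functors make sense is part
of the condition. -/
def CompatibleQ' : Prop :=
  IsNilpotent E.F ∧
  (∃ _ : HasProjectiveResolutions B, ∀ k j : ℕ, 0 < k → 0 < j → ∀ P : B, Projective P →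
    IsZero (((iter E.F j).leftDerived k).obj (E.F.obj P))) ∧
  ∀ Q : CochainComplex A ℤ, IsCompleteProjectiveResolution Q → ∀ j : ℕ, 0 < j →
    (((E.e ⋙ iter E.F j).mapHomologicalComplex _).obj Q).Acyclic ∧
      ∀ P : B, Projective P → HomAcyclic Q (E.l.obj ((iter E.F j).obj P))

/-- The cleft extension is compatible: it satisfies the condition concerning `l` and one of the two
forms of the condition concerning `q`. -/
def IsCompatible : Prop := E.CompatibleL ∧ (E.CompatibleQ ∨ E.CompatibleQ')

end CleftExtension

end

noncomputable section

namespace CleftExt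

variable {C : Type u₁} [Category.{v₁} C] [Abelian C]

/-! The splitting `el = Id ⊕ F` makes an object `X` of `A` behave like a module over `F` with
multiplication `η : F² ⟶ F`: it is `e(X)` together with a structure map `act : Fe(X) ⟶ e(X)`. In
this language `l(Y)` is the free module `Y ⊕ F(Y)`, `i(Y)` is `Y` with zero action, and `q(X)` is
the cokernel of `act`.

(1) ⇒ (2): condition (b2) implies (b1) by dimension shifting along `0 ⟶ Gᵏ⁺¹ ⟶ leGᵏ ⟶ Gᵏ ⟶ 0`, which
terminates because `G` is nilpotent along with `F` (`CompatibleQ'.compatibleQ`). Under (b1) the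
functor `q` preserves complete projective resolutions, hence the factorization of their
differentials through images. So `q` keeps the kernel of a projective cover `Q⁰ ⟶ X` monic, and
`map_mono_of_projective` transfers this to `u_X`.

(2) ⇔ (3): by right exactness of `q`, the cokernel of `α_X` is `qG(X)`, and `β_X` is the map induced
on it by `q(u_X)` (`exact_alpha_beta_iff`).

(3) ⇒ (1) for `η = 0`: here `α = F(act)` and `β = -act` (`alpha_eq`, `beta_eq`), so (3) says that `0
⟶ Fq(X) ⟶ e(X) ⟶ q(X) ⟶ 0` is exact. Given a complete resolution `P` of `q(X)`, the class of this
extension is represented by a cocycle `t : Pⁿ ⟶ F(Pⁿ⁺¹)` (`exists_cocycle_extension`). The objects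
`l(Pⁿ)` with differential `(d, t)` form a complete projective resolution (`twistComplex`) with `X`
as image in degree `0`. Testing against projectives of `A` reduces to objects `l(P')` by a Nakayama
argument. -/

/-! ### Complexes, Hom-acyclicity and right exact functors in abelian categories. -/

lemma HomAcyclic.exists_extension {P : CochainComplex C ℤ} {M : C} (h : HomAcyclic P M)
    (i j k : ℤ) (hij : i + 1 = j) (hjk : j + 1 = k) (f : P.X j ⟶ M) (hf : P.d i j ≫ f = 0) :
    ∃ g : P.X k ⟶ M, P.d j k ≫ g = f := by
  obtain rfl : i = j - 1 := by lia
  subst hjk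
  exact h j f hf

lemma exact_of_acyclic {P : CochainComplex C ℤ} (h : P.Acyclic) (i j k : ℤ)
    (hij : i + 1 = j) (hjk : j + 1 = k) :
    (ShortComplex.mk (P.d i j) (P.d j k) (P.d_comp_d i j k)).Exact :=
  (P.exactAt_iff' i j k (by simp [← hij]) (by simp [hjk])).1 (h j)

lemma exact_map_of_acyclic {D : Type u₂} [Category.{v₂} D] [Abelian D] {H : C ⥤ D} [H.Additive]
    {P : CochainComplex C ℤ} (h : ((H.mapHomologicalComplex _).obj P).Acyclic) (i j k : ℤ)
    (hij : i + 1 = j) (hjk : j + 1 = k) :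
    (ShortComplex.mk (H.map (P.d i j)) (H.map (P.d j k))
      (by rw [← H.map_comp, P.d_comp_d, H.map_zero])).Exact :=
  exact_of_acyclic h i j k hij hjk

lemma acyclic_of_exact_succ {P : CochainComplex C ℤ}
    (h : ∀ n : ℤ, (ShortComplex.mk (P.d n (n + 1)) (P.d (n + 1) (n + 1 + 1))
      (P.d_comp_d _ _ _)).Exact) : P.Acyclic := fun n => by
  obtain ⟨k, rfl⟩ : ∃ k, n = k + 1 := ⟨n - 1, by lia⟩
  exact (P.exactAt_iff' k (k + 1) (k + 1 + 1) (by simp) (by simp)).2 (h k)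

lemma homAcyclic_of_succ {P : CochainComplex C ℤ} {M : C}
    (h : ∀ (n : ℤ) (f : P.X (n + 1) ⟶ M), P.d n (n + 1) ≫ f = 0 →
      ∃ g : P.X (n + 1 + 1) ⟶ M, P.d (n + 1) (n + 1 + 1) ≫ g = f) : HomAcyclic P M := fun n => by
  obtain ⟨k, rfl⟩ : ∃ k, n = k + 1 := ⟨n - 1, by lia⟩
  intro f hf
  have hk : ∀ m, m = k + 1 - 1 → P.d m (k + 1) ≫ f = 0 := by
    rintro _ rfl
    exact hf
  exact h k f (hk k (by lia))

lemma exact_congr {X Y Z : C} {f f' : X ⟶ Y} {g g' : Y ⟶ Z} {w : f ≫ g = 0}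
    (h : (ShortComplex.mk f g w).Exact) (hf : f' = f) (hg : g' = g) :
    (ShortComplex.mk f' g' (by rw [hf, hg, w])).Exact := by
  subst hf hg
  exact h

/-- If `W ⟶ Y ⟶ Z` is exact and the second map factors through an epimorphism `π : Y ⟶ V` killing
the first one, then the remaining factor `V ⟶ Z` is a monomorphism. -/
lemma mono_of_exact_of_fac {W Y Z V : C} {f : W ⟶ Y} {g : Y ⟶ Z} {w : f ≫ g = 0}
    (h : (ShortComplex.mk f g w).Exact) (p : Y ⟶ V) (m : V ⟶ Z) [Epi p] (hp : f ≫ p = 0)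
    (fac : p ≫ m = g) : Mono m := by
  rw [Preadditive.mono_iff_cancel_zero]
  intro T y hy
  obtain ⟨T₁, π₁, _, y₁, h₁⟩ := surjective_up_to_refinements_of_epi p y
  obtain ⟨T₂, π₂, _, y₂, h₂⟩ := h.exact_up_to_refinements y₁ (by
    change y₁ ≫ g = 0
    rw [← fac, ← Category.assoc, ← h₁, Category.assoc, hy, comp_zero])
  dsimp at h₂
  rw [← cancel_epi π₁, ← cancel_epi π₂, h₁, reassoc_of% h₂, hp]
  simp

section Functor

variable {D : Type u₂} [Category.{v₂} D] [Abelian D] (H : C ⥤ D)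
  [PreservesFiniteColimits H]

lemma map_exact_of_epi [H.Additive] {X Y Z : C} {f : X ⟶ Y} {g : Y ⟶ Z} {w : f ≫ g = 0}
    (h : (ShortComplex.mk f g w).Exact) [Epi g] :
    (ShortComplex.mk (H.map f) (H.map g) (by rw [← H.map_comp, w, H.map_zero])).Exact := by
  have key := (H.preservesFiniteColimits_tfae.out 3 1 rfl rfl).1 ‹PreservesFiniteColimits H›
  exact (key (ShortComplex.mk f g w) ⟨h, ‹_›⟩).1

/-- If `f : W ⟶ Y` and `g = p ≫ m` stay exact under the right exact functor `H`, then `H(m)`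
is a monomorphism. -/
lemma map_mono_of_exact [H.Additive] {W Y Z V : C} {f : W ⟶ Y} {g : Y ⟶ Z} {p : Y ⟶ V}
    {m : V ⟶ Z} [Epi p] {h : H.map f ≫ H.map g = 0}
    (hH : (ShortComplex.mk (H.map f) (H.map g) h).Exact) (w : f ≫ p = 0) (fac : p ≫ m = g) :
    Mono (H.map m) :=
  mono_of_exact_of_fac hH (H.map p) (H.map m) (by rw [← H.map_comp, w, H.map_zero])
    (by rw [← H.map_comp, fac])

/-- If `H` keeps the kernel of one epimorphism `p : Y ⟶ X` from a projective object monic, then it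
keeps the kernel of every epimorphism onto `X` monic. -/
lemma map_mono_of_projective {K Y X G L : C} {k : K ⟶ Y} {p : Y ⟶ X} {u : G ⟶ L} {c : L ⟶ X}
    {wk : k ≫ p = 0} {wu : u ≫ c = 0} [Projective Y] [Epi p] [Epi c] [Mono u]
    (hk : (ShortComplex.mk k p wk).Exact) (hu : (ShortComplex.mk u c wu).Exact)
    [Mono (H.map k)] : Mono (H.map u) := by
  let r : Y ⟶ L := Projective.factorThru p c
  have hr : r ≫ c = p := Projective.factorThru_comp p c
  let s : K ⟶ G := hu.lift (k ≫ r) (by simp [hr, wk])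
  have hs : s ≫ u = k ≫ r := hu.lift_f _ _
  -- `L` need not be projective; projectivity of `Y` alone gives `r`. Both rows have cokernel `X`
  -- and `u` is monic, so the square is a pushout. `H` preserves it, and pushouts of monomorphisms
  -- are monomorphisms.
  have sq : CommSq k s r u := ⟨hs.symm⟩
  have : Epi (biprod.desc r u) := by
    rw [epi_iff_surjective_up_to_refinements]
    intro T y
    obtain ⟨T₁, π₁, _, y₁, h₁⟩ := surjective_up_to_refinements_of_epi p (y ≫ c)
    refine ⟨T₁, π₁, inferInstance, biprod.lift y₁ (hu.lift (π₁ ≫ y - y₁ ≫ r) ?_), ?_⟩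
    · simp [h₁, hr]
    · have := hu.lift_f (π₁ ≫ y - y₁ ≫ r) (by simp [h₁, hr])
      dsimp at this
      rw [biprod.lift_desc, this]
      abel
  have ex : sq.shortComplex.Exact := by
    rw [ShortComplex.exact_iff_exact_up_to_refinements]
    intro T y hy
    change T ⟶ Y ⊞ G at y
    change y ≫ biprod.desc r u = 0 at hy
    have hy' : (y ≫ biprod.fst) ≫ r + (y ≫ biprod.snd) ≫ u = 0 := by
      rw [← hy, biprod.desc_eq]
      simp
    obtain ⟨T₁, π₁, _, y₁, h₁⟩ := hk.exact_up_to_refinements (y ≫ biprod.fst) (by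
      have := hy' =≫ c
      simpa [wu, hr] using this)
    refine ⟨T₁, π₁, inferInstance, y₁, ?_⟩
    change π₁ ≫ y = y₁ ≫ biprod.lift k (-s)
    dsimp at h₁
    apply biprod.hom_ext
    · simp [h₁]
    · rw [← cancel_mono u]
      have := π₁ ≫= hy'
      rw [Preadditive.comp_add, ← Category.assoc π₁, h₁, Category.assoc, ← hs, comp_zero,
        Category.assoc] at this
      simp only [Category.assoc, biprod.lift_snd, Preadditive.neg_comp, Preadditive.comp_neg]
      exact (neg_eq_of_add_eq_zero_right this).symm
  have po : IsPushout k s r u :=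
    ⟨sq, ⟨sq.isColimitEquivIsColimitCokernelCofork.symm
      (haveI : Epi sq.shortComplex.g := this; ex.gIsCokernel)⟩⟩
  exact Abelian.mono_inr_of_isColimit _ _ (po.map H).isColimit

end Functor

/-- Two out of three for `Hom`-acyclicity along a short exact sequence `0 ⟶ M' ⟶ M ⟶ M'' ⟶ 0`. -/
lemma HomAcyclic.of_exact {P : CochainComplex C ℤ} (hP : ∀ n, Projective (P.X n))
    {M' M M'' : C} {u : M' ⟶ M} {c : M ⟶ M''} {w : u ≫ c = 0} [Mono u] [Epi c]
    (h : (ShortComplex.mk u c w).Exact) (h' : HomAcyclic P M') (h'' : HomAcyclic P M) :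
    HomAcyclic P M'' := by
  intro n f hf
  have := hP n
  let f₁ : P.X n ⟶ M := Projective.factorThru f c
  have hf₁ : f₁ ≫ c = f := Projective.factorThru_comp f c
  have hz : (P.d (n - 1) n ≫ f₁) ≫ c = 0 := by rw [Category.assoc, hf₁, hf]
  -- The lift `f₁` need not be a cocycle. Its defect `k` takes values in `M'`, is itself a cocycle,
  -- and is removed by subtracting an extension `k₁`.
  let k : P.X (n - 1) ⟶ M' := h.lift (P.d (n - 1) n ≫ f₁) hz
  have hk : k ≫ u = P.d (n - 1) n ≫ f₁ := h.lift_f _ _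
  obtain ⟨k₁, hk₁⟩ := h'.exists_extension (n - 1 - 1) (n - 1) n (by lia) (by lia) k (by
    rw [← cancel_mono u, Category.assoc, hk]
    simp)
  obtain ⟨g, hg⟩ := h'' n (f₁ - k₁ ≫ u) (by
    rw [Preadditive.comp_sub, reassoc_of% hk₁, hk, sub_self])
  refine ⟨g ≫ c, ?_⟩
  rw [reassoc_of% hg, Preadditive.sub_comp, Category.assoc, w, hf₁]
  simp

lemma HomAcyclic.of_iso {P : CochainComplex C ℤ} {M N : C} (h : HomAcyclic P M) (e : M ≅ N) :
    HomAcyclic P N := by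
  intro n f hf
  obtain ⟨g, hg⟩ := h n (f ≫ e.inv) (by rw [reassoc_of% hf, zero_comp])
  exact ⟨g ≫ e.hom, by rw [reassoc_of% hg]; simp⟩

lemma HomAcyclic.of_retract {P : CochainComplex C ℤ} {M N : C} (h : HomAcyclic P M)
    (s : N ⟶ M) (r : M ⟶ N) (hsr : s ≫ r = 𝟙 N) : HomAcyclic P N := by
  intro n f hf
  obtain ⟨g, hg⟩ := h n (f ≫ s) (by rw [reassoc_of% hf, zero_comp])
  exact ⟨g ≫ r, by rw [reassoc_of% hg, hsr, Category.comp_id]⟩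

/-- Let `P` be a complex of projectives and `K` an exact complex such that the complexes
`Hom(P, K n)` are exact. Then every `t : P b ⟶ K (b + 1)` compatible with the differentials extends
to a cocycle of degree one. -/
lemma exists_cocycle_extension {P K : CochainComplex C ℤ} (hP : ∀ n, Projective (P.X n))
    (hK : K.Acyclic) (hPK : ∀ n, HomAcyclic P (K.X n)) (b : ℤ)
    (t₀ : P.X b ⟶ K.X (b + 1))
    (h₀ : P.d (b - 1) b ≫ t₀ ≫ K.d (b + 1) (b + 1 + 1) = 0) :
    ∃ t : ∀ n : ℤ, P.X n ⟶ K.X (n + 1), t b = t₀ ∧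
      ∀ n : ℤ, P.d n (n + 1) ≫ t (n + 1) + t n ≫ K.d (n + 1) (n + 1 + 1) = 0 := by
  let M : ℤ → Type v₁ := fun n =>
    {t : P.X n ⟶ K.X (n + 1) // P.d (n - 1) n ≫ t ≫ K.d (n + 1) (n + 1 + 1) = 0}
  -- Upwards, the next term exists by `Hom`-acyclicity; downwards, by projectivity of `Pⁿ` and
  -- exactness of `K`. In both cases the condition carried by `M` is what the next step needs.
  have up (n : ℤ) (t : M n) : ∃ t' : M (n + 1),
      P.d n (n + 1) ≫ t'.1 + t.1 ≫ K.d (n + 1) (n + 1 + 1) = 0 := by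
    obtain ⟨s, hs⟩ := hPK (n + 1 + 1) n (-(t.1 ≫ K.d (n + 1) (n + 1 + 1))) (by
      rw [Preadditive.comp_neg, t.2, neg_zero])
    refine ⟨⟨s, ?_⟩, by rw [hs]; simp⟩
    have hm : ∀ m, m = n → P.d m (n + 1) ≫ s ≫ K.d (n + 1 + 1) (n + 1 + 1 + 1) = 0 := by
      rintro _ rfl
      rw [reassoc_of% hs]
      simp
    exact hm _ (by lia)
  have down (n : ℤ) (t : M (n + 1)) : ∃ t' : M n,
      P.d n (n + 1) ≫ t.1 + t'.1 ≫ K.d (n + 1) (n + 1 + 1) = 0 := by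
    have := hP n
    have ht : ∀ m, m = n + 1 - 1 →
        P.d m (n + 1) ≫ t.1 ≫ K.d (n + 1 + 1) (n + 1 + 1 + 1) = 0 := by
      rintro _ rfl
      exact t.2
    replace ht := ht n (by lia)
    have ex := exact_of_acyclic hK (n + 1) (n + 1 + 1) (n + 1 + 1 + 1) rfl rfl
    let s : P.X n ⟶ K.X (n + 1) := ex.liftFromProjective (-(P.d n (n + 1) ≫ t.1)) (by simp [ht])
    have hs : s ≫ K.d (n + 1) (n + 1 + 1) = -(P.d n (n + 1) ≫ t.1) :=
      ex.liftFromProjective_comp _ _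
    exact ⟨⟨s, by rw [hs]; simp⟩, by rw [hs]; simp⟩
  -- The same step indexed from `n` to `n - 1`, as integer induction requires. The heterogeneous
  -- equalities absorb the difference between `n - 1 + 1` and `n`.
  have down' (n : ℤ) (t : M n) : ∃ t' : M (n - 1), ∀ (m : ℤ) (hm : m = n - 1) (s : M m)
      (s' : M (m + 1)), HEq s t' → HEq s' t →
        P.d m (m + 1) ≫ s'.1 + s.1 ≫ K.d (m + 1) (m + 1 + 1) = 0 := by
    obtain ⟨m, rfl⟩ : ∃ m, n = m + 1 := ⟨n - 1, by lia⟩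
    obtain ⟨t', ht'⟩ := down m t
    refine ⟨cast (congrArg M (show m = m + 1 - 1 by lia)) t', ?_⟩
    intro k hk s s' hs hs'
    obtain rfl : k = m := by lia
    obtain rfl := eq_of_heq (hs.trans (cast_heq _ _))
    obtain rfl := eq_of_heq hs'
    exact ht'
  choose upf hup using up
  choose dnf hdn using down'
  let t (n : ℤ) : M n := n.inductionOn' b (⟨t₀, h₀⟩ : M b) (fun k _ => upf k) (fun k _ => dnf k)
  refine ⟨fun n => (t n).1, congrArg Subtype.val (Int.inductionOn'_self (motive := M)), fun n => ?_⟩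
  rcases le_or_gt b n with h | h
  · have : t (n + 1) = upf n (t n) := Int.inductionOn'_add_one (motive := M) h
    change P.d n (n + 1) ≫ (t (n + 1)).1 + (t n).1 ≫ K.d (n + 1) (n + 1 + 1) = 0
    rw [this]
    exact hup n (t n)
  · refine hdn (n + 1) (t (n + 1)) n (by lia) (t n) (t (n + 1)) ?_ HEq.rfl
    have : t (n + 1 - 1) = dnf (n + 1) (t (n + 1)) :=
      Int.inductionOn'_sub_one (motive := M) (by lia)
    have hm : ∀ m, m = n → HEq (t n) (t m) := by
      rintro _ rfl
      rfl
    rw [← this]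
    exact hm _ (by lia)

lemma isGorensteinProjective_iff (X : C) : IsGorensteinProjective X ↔
    ∃ P : CochainComplex C ℤ, IsCompleteProjectiveResolution P ∧
      ∃ (p : P.X 0 ⟶ X) (m : X ⟶ P.X 1), Epi p ∧ Mono m ∧ p ≫ m = P.d 0 1 := by
  constructor
  · rintro ⟨P, hP, ⟨φ⟩⟩
    exact ⟨P, hP, factorThruImage _ ≫ φ.inv, φ.hom ≫ image.ι _, epi_comp _ _, mono_comp _ _,
      by simp⟩
  · rintro ⟨P, hP, p, m, _, _, h⟩
    have := strongEpi_of_epi p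
    exact ⟨P, hP, ⟨image.isoStrongEpiMono p m h⟩⟩

/-- The iterates of functors intertwined by `e` are intertwined by `e`. -/
def iterIso {D : Type u₂} [Category.{v₂} D] [Abelian D] {G : C ⥤ C} {F : D ⥤ D} {e : C ⥤ D}
    (φ : G ⋙ e ≅ e ⋙ F) : ∀ n : ℕ, iter G n ⋙ e ≅ e ⋙ iter F n
  | 0 => e.leftUnitor ≪≫ e.rightUnitor.symm
  | n + 1 => Functor.associator _ _ _ ≪≫ Functor.isoWhiskerLeft (iter G n) φ ≪≫
      (Functor.associator _ _ _).symm ≪≫ Functor.isoWhiskerRight (iterIso φ n) F ≪≫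
      Functor.associator _ _ _

lemma acyclic_of_natIso {D : Type u₂} [Category.{v₂} D] [Abelian D] {H K : C ⥤ D}
    [H.Additive] [K.Additive] (φ : H ≅ K) {P : CochainComplex C ℤ}
    (h : ((H.mapHomologicalComplex _).obj P).Acyclic) :
    ((K.mapHomologicalComplex _).obj P).Acyclic := fun n =>
  (h n).of_iso ((NatIso.mapHomologicalComplex φ _).app P)

lemma acyclic_map_of_exact {D : Type u₂} [Category.{v₂} D] [Abelian D] (H : C ⥤ D)
    [H.Additive] [PreservesFiniteLimits H] [PreservesFiniteColimits H] {P : CochainComplex C ℤ}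
    (h : P.Acyclic) : ((H.mapHomologicalComplex _).obj P).Acyclic := fun n =>
  ShortComplex.Exact.map (h n) H

lemma acyclic_X₃ {S : ShortComplex (CochainComplex C ℤ)} (hS : S.ShortExact)
    (h₁ : S.X₁.Acyclic) (h₂ : S.X₂.Acyclic) : S.X₃.Acyclic := fun n => by
  rw [HomologicalComplex.exactAt_iff_isZero_homology]
  exact (hS.homology_exact₃ n (n + 1) rfl).isZero_of_both_zeros
    ((h₂ n).isZero_homology.eq_of_src _ _) ((h₁ (n + 1)).isZero_homology.eq_of_tgt _ _)

end CleftExt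

/-! ### Objects of `A` as modules over `F`. -/

namespace CleftExtension

open CleftExt

variable {B : Type u₁} [Category.{v₁} B] [Abelian B] {A : Type u₂} [Category.{v₂} A] [Abelian A]
variable (E : CleftExtension B A)

/-- The inclusion `F(Y) ⟶ el(Y)`. -/
def inc (Y : B) : E.F.obj Y ⟶ E.e.obj (E.l.obj Y) := E.nu.app Y

/-- The projection `el(Y) ⟶ F(Y)`. -/
def ret (Y : B) : E.e.obj (E.l.obj Y) ⟶ E.F.obj Y := E.nu'.app Y

/-- The projection `el(Y) ⟶ Y`. -/
def aug (Y : B) : E.e.obj (E.l.obj Y) ⟶ Y := E.proj.app Y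

/-- The inclusion `Y ⟶ el(Y)`. -/
def unt (Y : B) : Y ⟶ E.e.obj (E.l.obj Y) := E.adj.unit.app Y

/-- The counit `le(X) ⟶ X`. -/
def cou (X : A) : E.l.obj (E.e.obj X) ⟶ X := E.adj.counit.app X

/-- The multiplication `F²(Y) ⟶ F(Y)`. -/
def mulF (Y : B) : E.F.obj (E.F.obj Y) ⟶ E.F.obj Y := E.eta.app Y

/-- The inclusion `G(X) ⟶ le(X)`. -/
def inG (X : A) : E.G.obj X ⟶ E.l.obj (E.e.obj X) := E.u.app X

instance (X : A) : Epi (E.cou X) := inferInstanceAs (Epi (E.adj.counit.app X))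

instance (X : A) : Mono (E.inG X) := inferInstanceAs (Mono (E.u.app X))

/-- The isomorphism `ei(Y) ⟶ Y`. -/
def eiHom (Y : B) : E.e.obj (E.i.obj Y) ⟶ Y := E.ei.hom.app Y

/-- The isomorphism `Y ⟶ ei(Y)`. -/
def eiInv (Y : B) : Y ⟶ E.e.obj (E.i.obj Y) := E.ei.inv.app Y

/-- The isomorphism `ql(Y) ⟶ Y`. -/
def qlHom (Y : B) : E.q.obj (E.l.obj Y) ⟶ Y := E.qlIso.hom.app Y

/-- The isomorphism `Y ⟶ ql(Y)`. -/
def qlInv (Y : B) : Y ⟶ E.q.obj (E.l.obj Y) := E.qlIso.inv.app Y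

instance (Y : B) : IsIso (E.eiHom Y) := inferInstanceAs (IsIso (E.ei.hom.app Y))

instance (Y : B) : IsIso (E.eiInv Y) := inferInstanceAs (IsIso (E.ei.inv.app Y))

instance (Y : B) : IsIso (E.qlHom Y) := inferInstanceAs (IsIso (E.qlIso.hom.app Y))

@[simp]
lemma inG_cou (X : A) : E.inG X ≫ E.cou X = 0 := E.u_counit X

lemma exact_inG_cou (X : A) : (ShortComplex.mk (E.inG X) (E.cou X) (E.inG_cou X)).Exact :=
  ShortComplex.exact_kernel (E.adj.counit.app X)

@[simp]
lemma inc_ret (Y : B) : E.inc Y ≫ E.ret Y = 𝟙 _ := E.nu_nu' Y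

@[simp]
lemma inc_aug (Y : B) : E.inc Y ≫ E.aug Y = 0 := E.nu_proj Y

@[simp]
lemma unt_aug (Y : B) : E.unt Y ≫ E.aug Y = 𝟙 _ := E.unit_proj Y

@[simp]
lemma unt_ret (Y : B) : E.unt Y ≫ E.ret Y = 0 := E.unit_nu' Y

@[simp]
lemma inc_ret_assoc (Y : B) {Z : B} (f : E.F.obj Y ⟶ Z) : E.inc Y ≫ E.ret Y ≫ f = f := by
  rw [reassoc_of% E.inc_ret Y]

@[simp]
lemma inc_aug_assoc (Y : B) {Z : B} (f : Y ⟶ Z) : E.inc Y ≫ E.aug Y ≫ f = 0 := by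
  rw [reassoc_of% E.inc_aug Y, zero_comp]

@[simp]
lemma unt_aug_assoc (Y : B) {Z : B} (f : Y ⟶ Z) : E.unt Y ≫ E.aug Y ≫ f = f := by
  rw [reassoc_of% E.unt_aug Y]

@[simp]
lemma unt_ret_assoc (Y : B) {Z : B} (f : E.F.obj Y ⟶ Z) : E.unt Y ≫ E.ret Y ≫ f = 0 := by
  rw [reassoc_of% E.unt_ret Y, zero_comp]

lemma aug_unt_add_ret_inc (Y : B) : E.aug Y ≫ E.unt Y + E.ret Y ≫ E.inc Y = 𝟙 _ := by
  have h : E.ret Y ≫ E.inc Y = 𝟙 _ - E.aug Y ≫ E.unt Y := E.nu'_nu Y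
  rw [h]
  abel

lemma decomp {Y W : B} (f : W ⟶ E.e.obj (E.l.obj Y)) :
    f = (f ≫ E.aug Y) ≫ E.unt Y + (f ≫ E.ret Y) ≫ E.inc Y := by
  rw [Category.assoc, Category.assoc, ← Preadditive.comp_add, aug_unt_add_ret_inc,
    Category.comp_id]

lemma decomp' {Y W : B} (f : E.e.obj (E.l.obj Y) ⟶ W) :
    f = E.aug Y ≫ E.unt Y ≫ f + E.ret Y ≫ E.inc Y ≫ f := by
  rw [← Category.assoc, ← Category.assoc, ← Preadditive.add_comp, aug_unt_add_ret_inc,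
    Category.id_comp]

lemma inc_nat {Y Z : B} (f : Y ⟶ Z) :
    E.inc Y ≫ E.e.map (E.l.map f) = E.F.map f ≫ E.inc Z := (E.nu.naturality f).symm

lemma ret_nat {Y Z : B} (f : Y ⟶ Z) :
    E.e.map (E.l.map f) ≫ E.ret Z = E.ret Y ≫ E.F.map f := E.nu'.naturality f

lemma unt_nat {Y Z : B} (f : Y ⟶ Z) :
    E.unt Y ≫ E.e.map (E.l.map f) = f ≫ E.unt Z := (E.adj.unit.naturality f).symm

lemma cou_nat {X Z : A} (f : X ⟶ Z) :
    E.l.map (E.e.map f) ≫ E.cou Z = E.cou X ≫ f := E.adj.counit.naturality f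

lemma inG_nat {X Z : A} (f : X ⟶ Z) :
    E.G.map f ≫ E.inG Z = E.inG X ≫ E.l.map (E.e.map f) := E.u.naturality f

lemma unt_cou (X : A) : E.unt (E.e.obj X) ≫ E.e.map (E.cou X) = 𝟙 _ :=
  E.adj.right_triangle_components X

lemma map_unt_cou (Y : B) : E.l.map (E.unt Y) ≫ E.cou (E.l.obj Y) = 𝟙 _ :=
  E.adj.left_triangle_components Y

/-- The morphism `l(Y) ⟶ X` corresponding to `Y ⟶ e(X)`. -/
def ext {Y : B} {X : A} (f : Y ⟶ E.e.obj X) : E.l.obj Y ⟶ X := E.l.map f ≫ E.cou X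

lemma unt_ext {Y : B} {X : A} (f : Y ⟶ E.e.obj X) : E.unt Y ≫ E.e.map (E.ext f) = f := by
  rw [ext, Functor.map_comp, ← Category.assoc, unt_nat, Category.assoc, unt_cou, Category.comp_id]

lemma ext_comp {Y : B} {X Z : A} (f : Y ⟶ E.e.obj X) (g : X ⟶ Z) :
    E.ext f ≫ g = E.ext (f ≫ E.e.map g) := by
  rw [ext, ext, Category.assoc, ← cou_nat, Functor.map_comp, Category.assoc]

lemma ext_unt_comp {Y : B} {X : A} (f : E.l.obj Y ⟶ X) : E.ext (E.unt Y ≫ E.e.map f) = f := by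
  rw [← ext_comp, ext, map_unt_cou, Category.id_comp]

lemma hom_ext {Y : B} {X : A} {f g : E.l.obj Y ⟶ X}
    (h : E.unt Y ≫ E.e.map f = E.unt Y ≫ E.e.map g) : f = g := by
  rw [← E.ext_unt_comp f, h, ext_unt_comp]

/-- The structure map `Fe(X) ⟶ e(X)` of an object of `A`. -/
def act (X : A) : E.F.obj (E.e.obj X) ⟶ E.e.obj X := E.inc (E.e.obj X) ≫ E.e.map (E.cou X)

lemma act_nat {X Z : A} (f : X ⟶ Z) :
    E.act X ≫ E.e.map f = E.F.map (E.e.map f) ≫ E.act Z := by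
  rw [act, act, Category.assoc, ← Functor.map_comp, ← cou_nat, Functor.map_comp, ← Category.assoc,
    inc_nat, Category.assoc]

lemma inc_ext {Y : B} {X : A} (f : Y ⟶ E.e.obj X) :
    E.inc Y ≫ E.e.map (E.ext f) = E.F.map f ≫ E.act X := by
  rw [ext, Functor.map_comp, ← Category.assoc, inc_nat, Category.assoc, act]

lemma map_cou (X : A) :
    E.e.map (E.cou X) = E.aug (E.e.obj X) + E.ret (E.e.obj X) ≫ E.act X := by
  rw [E.decomp' (E.e.map (E.cou X)), unt_cou, Category.comp_id, act]

/-- A morphism `e(X) ⟶ e(Z)` compatible with the structure maps comes from `X ⟶ Z`. -/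
lemma exists_lift {X Z : A} (g : E.e.obj X ⟶ E.e.obj Z)
    (h : E.act X ≫ g = E.F.map g ≫ E.act Z) : ∃ f : X ⟶ Z, E.e.map f = g := by
  have key : E.e.map (E.cou X) ≫ g = E.e.map (E.ext g) := by
    rw [E.decomp' (E.e.map (E.ext g)), unt_ext, inc_ext, ← h, map_cou, Preadditive.add_comp,
      Category.assoc]
  have hz : E.inG X ≫ E.ext g = 0 := E.e.map_injective (by
    rw [Functor.map_comp, ← key, ← Category.assoc, ← Functor.map_comp, inG_cou]
    simp)
  refine ⟨(E.exact_inG_cou X).desc (E.ext g) hz, ?_⟩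
  have hd : E.cou X ≫ (E.exact_inG_cou X).desc (E.ext g) hz = E.ext g :=
    (E.exact_inG_cou X).g_desc _ _
  rw [← cancel_epi (E.e.map (E.cou X)), ← Functor.map_comp, hd, key]

/-- The projection `l(Y) ⟶ i(Y)`. -/
def toI (Y : B) : E.l.obj Y ⟶ E.i.obj Y := E.ext (E.eiInv Y)

lemma ei_hom_inv (Y : B) : E.eiHom Y ≫ E.eiInv Y = 𝟙 (E.e.obj (E.i.obj Y)) :=
  E.ei.hom_inv_id_app Y

lemma ei_inv_hom (Y : B) : E.eiInv Y ≫ E.eiHom Y = 𝟙 Y :=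
  E.ei.inv_hom_id_app Y

lemma ei_nat {Y Z : B} (f : Y ⟶ Z) :
    E.e.map (E.i.map f) ≫ E.eiHom Z = E.eiHom Y ≫ f := E.ei.hom.naturality f

lemma ei_inv_nat {Y Z : B} (f : Y ⟶ Z) :
    E.eiInv Y ≫ E.e.map (E.i.map f) = f ≫ E.eiInv Z := (E.ei.inv.naturality f).symm

lemma map_toI (Y : B) : E.e.map (E.toI Y) ≫ E.eiHom Y = E.aug Y := by
  rw [toI, ext, Functor.map_comp, Category.assoc]
  rfl

-- The projection `el(Y) ⟶ Y` is `e` applied to the morphism `l(Y) ⟶ i(Y)`, and it kills `F(Y)`; so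
-- the action on `i(Y)` is trivial.
@[simp]
lemma act_i (Y : B) : E.act (E.i.obj Y) = 0 := by
  have h : E.F.map (E.eiInv Y) ≫ E.act (E.i.obj Y) = 0 := by
    rw [← inc_ext, ← cancel_mono (E.eiHom Y), Category.assoc]
    change E.inc Y ≫ E.e.map (E.toI Y) ≫ E.eiHom Y = _
    rw [map_toI, inc_aug, zero_comp]
  have h' : E.F.map (E.eiHom Y) ≫ E.F.map (E.eiInv Y) =
      𝟙 (E.F.obj (E.e.obj (E.i.obj Y))) := by
    rw [← Functor.map_comp, ei_hom_inv, CategoryTheory.Functor.map_id]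
  rw [← Category.id_comp (E.act _), ← h', Category.assoc, h, comp_zero]

lemma map_unt_act (Y : B) : E.F.map (E.unt Y) ≫ E.act (E.l.obj Y) = E.inc Y := by
  rw [← inc_ext, ext, map_unt_cou]
  simp

/-- The `Y`-component vanishes because `l(Y) ⟶ i(Y)` comes from `A` and kills the summand `F(Y)`;
the `F(Y)`-component is `η` by definition. -/
lemma map_inc_act (Y : B) :
    E.F.map (E.inc Y) ≫ E.act (E.l.obj Y) = E.mulF Y ≫ E.inc Y := by
  have h1 : (E.F.map (E.inc Y) ≫ E.act (E.l.obj Y)) ≫ E.aug Y = 0 := by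
    rw [← inc_ext, ← map_toI, ← Category.assoc, Category.assoc _ _ (E.e.map (E.toI Y)),
      ← Functor.map_comp, ext_comp]
    have : E.inc Y ≫ E.e.map (E.toI Y) = 0 := by
      rw [← cancel_mono (E.eiHom Y), Category.assoc, map_toI, inc_aug, zero_comp]
    rw [this, inc_ext, Functor.map_zero, zero_comp, zero_comp]
  have h2 : (E.F.map (E.inc Y) ≫ E.act (E.l.obj Y)) ≫ E.ret Y = E.mulF Y := by
    rw [← inc_ext, ext, Functor.map_comp, Category.assoc, Category.assoc]
    rfl
  rw [E.decomp (E.F.map (E.inc Y) ≫ E.act (E.l.obj Y)), h1, h2, zero_comp, zero_add]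

/-- The associativity law of the structure maps. -/
lemma map_act_act (X : A) :
    E.F.map (E.act X) ≫ E.act X = E.mulF (E.e.obj X) ≫ E.act X := by
  have h : E.F.map (E.act X) = E.F.map (E.inc (E.e.obj X)) ≫ E.F.map (E.e.map (E.cou X)) := by
    rw [act, Functor.map_comp]
  rw [h, Category.assoc, ← act_nat, ← Category.assoc, map_inc_act, Category.assoc, act]

/-! ### Right exactness of `F`, and `q` as the cokernel of the action. -/

instance : PreservesFiniteColimits E.l :=
  haveI := E.adj.leftAdjoint_preservesColimits
  inferInstance

instance : PreservesFiniteColimits E.q :=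
  haveI := E.qAdj.leftAdjoint_preservesColimits
  inferInstance

/-- `F` is a natural direct summand of the right exact functor `el`. -/
instance : PreservesFiniteColimits E.F := by
  refine (E.F.preservesFiniteColimits_tfae.out 1 3 rfl rfl).1 ?_
  rintro S ⟨hS, hg⟩
  constructor
  · have h := map_exact_of_epi (E.l ⋙ E.e) (w := S.zero) hS
    rw [ShortComplex.exact_iff_exact_up_to_refinements]
    intro T y hy
    change T ⟶ E.F.obj S.X₂ at y
    change y ≫ E.F.map S.g = 0 at hy
    obtain ⟨T', π, hπ, x, hx⟩ := h.exact_up_to_refinements (y ≫ E.inc S.X₂) (by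
      change (y ≫ E.inc S.X₂) ≫ E.e.map (E.l.map S.g) = 0
      rw [Category.assoc, inc_nat, reassoc_of% hy, zero_comp])
    change T' ⟶ E.e.obj (E.l.obj S.X₁) at x
    change π ≫ y ≫ E.inc S.X₂ = x ≫ E.e.map (E.l.map S.f) at hx
    refine ⟨T', π, hπ, x ≫ E.ret S.X₁, ?_⟩
    have := hx =≫ E.ret S.X₂
    rw [Category.assoc, Category.assoc, inc_ret, Category.comp_id, Category.assoc, ret_nat] at this
    exact this.trans (Category.assoc _ _ _).symm
  · rw [Preadditive.epi_iff_cancel_zero]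
    intro T w hw
    have : E.e.map (E.l.map S.g) ≫ E.ret S.X₃ ≫ w = 0 := by
      rw [← Category.assoc, ret_nat, Category.assoc, hw, comp_zero]
    have : E.ret S.X₃ ≫ w = 0 := by
      rw [← cancel_epi (E.e.map (E.l.map S.g)), this, comp_zero]
    rw [← E.inc_ret_assoc S.X₃ w, this, comp_zero]

/-- The unit `X ⟶ iq(X)`. -/
def unq (X : A) : X ⟶ E.i.obj (E.q.obj X) := E.qAdj.unit.app X

/-- The projection `e(X) ⟶ q(X)`. -/
def toQ (X : A) : E.e.obj X ⟶ E.q.obj X := E.e.map (E.unq X) ≫ E.eiHom (E.q.obj X)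

lemma toQ_nat {X Z : A} (f : X ⟶ Z) : E.e.map f ≫ E.toQ Z = E.toQ X ≫ E.q.map f := by
  have h : f ≫ E.unq Z = E.unq X ≫ E.i.map (E.q.map f) := E.qAdj.unit.naturality f
  rw [toQ, toQ, ← Category.assoc, ← Functor.map_comp, h, Functor.map_comp, Category.assoc, ei_nat,
    Category.assoc]

@[simp]
lemma act_toQ (X : A) : E.act X ≫ E.toQ X = 0 := by
  rw [toQ, ← Category.assoc, act_nat, act_i, comp_zero, zero_comp]

/-- A map from `e(X)` that kills the action is a module morphism to `W` with zero action, hence a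
morphism `X ⟶ i(W)`; now apply `q ⊣ i`. -/
lemma toQ_desc {X : A} {W : B} (f : E.e.obj X ⟶ W) (hf : E.act X ≫ f = 0) :
    ∃ g : E.q.obj X ⟶ W, E.toQ X ≫ g = f := by
  obtain ⟨k, hk⟩ := E.exists_lift (X := X) (Z := E.i.obj W) (f ≫ E.eiInv W) (by
    rw [act_i, comp_zero, reassoc_of% hf, zero_comp])
  let g : E.q.obj X ⟶ W := (E.qAdj.homEquiv X W).symm k
  have hg : E.unq X ≫ E.i.map g = k := by
    have := (E.qAdj.homEquiv X W).apply_symm_apply k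
    rwa [Adjunction.homEquiv_unit] at this
  refine ⟨g, ?_⟩
  rw [toQ, Category.assoc, ← ei_nat, ← Category.assoc, ← Functor.map_comp, hg, hk, Category.assoc,
    ei_inv_hom, Category.comp_id]

instance (X : A) : Epi (E.toQ X) := by
  rw [Preadditive.epi_iff_cancel_zero]
  intro W w hw
  have h : E.unq X ≫ E.i.map w = 0 := E.e.map_injective (by
    rw [← cancel_mono (E.eiHom W), Functor.map_comp, Category.assoc, ei_nat, ← Category.assoc]
    change E.toQ X ≫ w = _
    rw [hw, Functor.map_zero, zero_comp])
  apply (E.qAdj.homEquiv X W).injective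
  rw [Adjunction.homEquiv_unit, Adjunction.homEquiv_unit, Functor.map_zero, comp_zero]
  exact h

lemma exact_act_toQ (X : A) : (ShortComplex.mk (E.act X) (E.toQ X) (E.act_toQ X)).Exact := by
  obtain ⟨g, hg⟩ := E.toQ_desc (cokernel.π (E.act X)) (cokernel.condition _)
  rw [ShortComplex.exact_iff_exact_up_to_refinements]
  intro T y hy
  dsimp at y hy
  exact (ShortComplex.exact_cokernel (E.act X)).exact_up_to_refinements y (by
    change y ≫ cokernel.π (E.act X) = 0
    rw [← hg, reassoc_of% hy, zero_comp])

lemma toQ_l (Y : B) : E.toQ (E.l.obj Y) ≫ E.qlHom Y = E.aug Y := by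
  have h := Adjunction.unit_leftAdjointUniq_hom_app (E.adj.comp E.qAdj) E.idAdj Y
  have h2 : E.unq (E.l.obj Y) ≫ E.i.map (E.qlHom Y) = E.toI Y := by
    apply E.hom_ext
    rw [toI, unt_ext, Functor.map_comp]
    have h3 : E.idAdj.unit.app Y = E.eiInv Y := by
      simp [idAdj, eiInv]
    rw [← h3, ← h]
    simp [unt, unq, qlHom, qlIso]
  rw [toQ, Category.assoc, ← map_toI, ← h2, Functor.map_comp, Category.assoc, ei_nat]

lemma unt_toQ (Y : B) : E.unt Y ≫ E.toQ (E.l.obj Y) = E.qlInv Y := by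
  rw [← cancel_mono (E.qlHom Y), Category.assoc, toQ_l, unt_aug]
  exact (E.qlIso.inv_hom_id_app Y).symm

/-- The functor `q` on a morphism between objects `l(Y)`, read through `ql ≅ Id`. -/
lemma qlIso_conj {Y Z : B} (k : E.l.obj Y ⟶ E.l.obj Z) :
    E.qlInv Y ≫ E.q.map k ≫ E.qlHom Z = E.unt Y ≫ E.e.map k ≫ E.aug Z := by
  rw [← unt_toQ, ← toQ_l, Category.assoc, ← Category.assoc (E.toQ _), ← toQ_nat, Category.assoc]

/-! ### The maps `α` and `β` in terms of the action, and (2) ⇔ (3). -/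

lemma eGIso_inv_inG (X : A) : (E.eGIso X).inv ≫ E.e.map (E.inG X) =
    E.inc (E.e.obj X) - E.act X ≫ E.unt (E.e.obj X) := by
  have h : E.retr X ≫ E.e.map (E.inG X) = 𝟙 _ - E.e.map (E.cou X) ≫ E.unt (E.e.obj X) := E.retr_u X
  change (E.inc _ ≫ E.retr X) ≫ E.e.map (E.inG X) = _
  rw [Category.assoc, h, Preadditive.comp_sub, Category.comp_id, act, Category.assoc]

/-- The sign arises because `Fe(X)` is moved into the kernel of the counit by subtracting `act ≫
unt`, and the augmentation sees only that correction. -/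
lemma beta_eq (X : A) : E.beta X = -E.act X := by
  have h : E.beta X = (E.eGIso X).inv ≫ E.qlInv _ ≫ E.q.map (E.cou (E.G.obj X) ≫ E.inG X) ≫
      E.qlHom (E.e.obj X) := by
    rw [Functor.map_comp, Category.assoc]
    rfl
  rw [h, qlIso_conj, Functor.map_comp, Category.assoc, ← Category.assoc (E.unt _), unt_cou,
    Category.id_comp, ← Category.assoc, eGIso_inv_inG]
  simp

lemma alpha_eq (X : A) : E.alpha X = E.F.map (E.act X) - E.mulF (E.e.obj X) := by
  have h : E.alpha X = E.F.map (E.eGIso X).inv ≫ E.beta (E.G.obj X) ≫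
      E.e.map (E.inG X) ≫ E.ret (E.e.obj X) := by
    simp only [alpha, beta, Category.assoc]
    rfl
  rw [h, beta_eq, Preadditive.neg_comp, ← Category.assoc (E.act _), act_nat, Category.assoc,
    Preadditive.comp_neg, ← Category.assoc (E.F.map _), ← Functor.map_comp, eGIso_inv_inG,
    Functor.map_sub, Functor.map_comp, Preadditive.sub_comp,
    Category.assoc, ← Category.assoc (E.F.map (E.inc _)), map_inc_act,
    ← Category.assoc (E.F.map (E.unt _)), map_unt_act]
  simp

/-- The sequence `F²e(X) ⟶ Fe(X) ⟶ e(X)` is exact exactly when `q(u_X)` is a monomorphism. -/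
lemma exact_alpha_beta_iff (X : A) :
    (ShortComplex.mk (E.alpha X) (E.beta X) (E.alpha_beta X)).Exact ↔ Mono (E.q.map (E.inG X)) := by
  have w : E.q.map (E.inG (E.G.obj X)) ≫ E.q.map (E.cou (E.G.obj X)) = 0 := by
    rw [← Functor.map_comp, inG_cou, Functor.map_zero]
  let f := E.q.map (E.cou (E.G.obj (E.G.obj X))) ≫ E.q.map (E.inG (E.G.obj X))
  let g := E.q.map (E.cou (E.G.obj X)) ≫ E.q.map (E.inG X)
  have wf : f ≫ E.q.map (E.cou (E.G.obj X)) = 0 := by rw [Category.assoc, w, comp_zero]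
  have wg : f ≫ g = 0 := by rw [← Category.assoc, wf, zero_comp]
  let S := ShortComplex.mk f g wg
  let S₀ := ShortComplex.mk f _ wf
  let T := ShortComplex.mk (E.q.map (E.inG (E.G.obj X))) _ w
  let φ : S₀ ⟶ T :=
    { τ₁ := E.q.map (E.cou (E.G.obj (E.G.obj X)))
      τ₂ := 𝟙 _
      τ₃ := 𝟙 _
      comm₁₂ := (Category.comp_id _).symm
      comm₂₃ := (Category.id_comp _).trans (Category.comp_id _).symm }
  -- Exactness of `qG² ⟶ qleG ⟶ qG` survives precomposition with the epimorphism `q(λ_{G²X})`. Hence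
  -- `q(λ_{GX})` is a cokernel of `f`, and exactness of `(f, g)` is decided by the remaining factor
  -- `q(u_X)` of `g`.
  have hT : T.Exact := map_exact_of_epi E.q (E.exact_inG_cou (E.G.obj X))
  have hS₀ : S₀.Exact := by
    have : Epi φ.τ₁ := inferInstanceAs (Epi (E.q.map (E.cou (E.G.obj (E.G.obj X)))))
    have : IsIso φ.τ₂ := inferInstanceAs (IsIso (𝟙 _))
    have : Mono φ.τ₃ := inferInstanceAs (Mono (𝟙 _))
    exact (ShortComplex.exact_iff_of_epi_of_isIso_of_mono φ).2 hT
  let ψ : S₀ ⟶ S :=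
    { τ₁ := 𝟙 _
      τ₂ := 𝟙 _
      τ₃ := E.q.map (E.inG X)
      comm₁₂ := (Category.id_comp _).trans (Category.comp_id _).symm
      comm₂₃ := Category.id_comp _ }
  let κ : ShortComplex.mk (E.alpha X) (E.beta X) (E.alpha_beta X) ≅ S :=
    ShortComplex.isoMk
      (E.F.mapIso (E.eGIso X).symm ≪≫ (E.eGIso (E.G.obj X)).symm ≪≫
        E.qlIso.symm.app (E.e.obj (E.G.obj (E.G.obj X))))
      ((E.eGIso X).symm ≪≫ E.qlIso.symm.app (E.e.obj (E.G.obj X)))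
      (E.qlIso.symm.app (E.e.obj X))
      (by simp [alpha, S, f, cou, inG]) (by simp [beta, S, g, cou, inG])
  rw [ShortComplex.exact_iff_of_iso κ]
  constructor
  · intro h
    exact mono_of_exact_of_fac h _ _ wf rfl
  · intro h
    have : Epi ψ.τ₁ := inferInstanceAs (Epi (𝟙 _))
    have : IsIso ψ.τ₂ := inferInstanceAs (IsIso (𝟙 _))
    have : Mono ψ.τ₃ := h
    exact (ShortComplex.exact_iff_of_epi_of_isIso_of_mono ψ).1 hS₀

/-! ### Consequences of compatibility: (b2) ⇒ (b1), and (1) ⇒ (2). -/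

instance : E.i.PreservesEpimorphisms where
  preserves {X Y} f _ := by
    apply E.e.epi_of_epi_map
    have h : E.e.map (E.i.map f) = E.eiHom X ≫ f ≫ E.eiInv Y := by
      rw [← ei_inv_nat, ← Category.assoc, ei_hom_inv, Category.id_comp]
    rw [h]
    infer_instance

instance (P : B) [Projective P] : Projective (E.l.obj P) :=
  E.adj.map_projective P ‹_›

instance (P : A) [Projective P] : Projective (E.q.obj P) :=
  E.qAdj.map_projective P ‹_›

/-- The isomorphism `eG ≅ Fe`, as an isomorphism of functors. -/
def eGNatIso : E.G ⋙ E.e ≅ E.e ⋙ E.F :=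
  NatIso.ofComponents E.eGIso fun {X Z} f => by
    change E.e.map (E.G.map f) ≫ E.e.map (E.inG Z) ≫ E.ret (E.e.obj Z) =
      (E.e.map (E.inG X) ≫ E.ret (E.e.obj X)) ≫ E.F.map (E.e.map f)
    rw [← Category.assoc, ← Functor.map_comp, inG_nat, Functor.map_comp, Category.assoc,
      Category.assoc, ret_nat]

lemma cou_splitEpi_of_retract {X : A} {Y : B} (r : Retract X (E.l.obj Y)) :
    ∃ s : X ⟶ E.l.obj (E.e.obj X), s ≫ E.cou X = 𝟙 X :=
  ⟨r.i ≫ E.l.map (E.unt Y) ≫ E.l.map (E.e.map r.r), by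
    rw [Category.assoc, Category.assoc, cou_nat, ← Category.assoc (E.l.map (E.unt Y)), map_unt_cou,
      Category.id_comp, r.retract]⟩

lemma inG_splitMono_of_section {X : A} {s : X ⟶ E.l.obj (E.e.obj X)} (hs : s ≫ E.cou X = 𝟙 X) :
    ∃ r : E.l.obj (E.e.obj X) ⟶ E.G.obj X, E.inG X ≫ r = 𝟙 _ ∧ s ≫ r = 0 := by
  have w : (𝟙 _ - E.cou X ≫ s) ≫ E.cou X = 0 := by
    rw [Preadditive.sub_comp, Category.assoc, hs]
    simp
  have hr : (E.exact_inG_cou X).lift (𝟙 _ - E.cou X ≫ s) w ≫ E.inG X = 𝟙 _ - E.cou X ≫ s :=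
    (E.exact_inG_cou X).lift_f _ _
  refine ⟨(E.exact_inG_cou X).lift (𝟙 _ - E.cou X ≫ s) w, ?_, ?_⟩
  · rw [← cancel_mono (E.inG X), Category.assoc, hr, Preadditive.comp_sub, ← Category.assoc,
      inG_cou]
    simp
  · rw [← cancel_mono (E.inG X), Category.assoc, hr, Preadditive.comp_sub, ← Category.assoc, hs]
    simp

/-- The counit at a retract of a free object splits, so `u_X` is a split monomorphism, which every
functor preserves. This gives degreewise short exactness in `acyclic_q_of_acyclic_q_G`. -/
lemma mono_q_inG_of_retract {X : A} {Y : B} (r : Retract X (E.l.obj Y)) :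
    Mono (E.q.map (E.inG X)) := by
  obtain ⟨s, hs⟩ := E.cou_splitEpi_of_retract r
  obtain ⟨t, ht, -⟩ := E.inG_splitMono_of_section hs
  have : Mono (E.q.map (E.inG X) ≫ E.q.map t) := by
    rw [← Functor.map_comp, ht, CategoryTheory.Functor.map_id]
    infer_instance
  exact mono_of_mono _ (E.q.map t)

/-- `Gl(Y)` is a retract of `lF(Y)`. -/
lemma exists_retract_G_l (Y : B) :
    Nonempty (Retract (E.G.obj (E.l.obj Y)) (E.l.obj (E.F.obj Y))) := by
  obtain ⟨t, ht, h0⟩ := E.inG_splitMono_of_section (E.map_unt_cou Y)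
  -- Inside `lel(Y)`, both `Gl(Y)` and `lF(Y)` are complements of the image of `l(unt)`.
  refine ⟨⟨E.inG _ ≫ E.l.map (E.ret Y), E.l.map (E.inc Y) ≫ t, ?_⟩⟩
  have h : E.l.map (E.ret Y ≫ E.inc Y) = 𝟙 _ - E.l.map (E.aug Y) ≫ E.l.map (E.unt Y) := by
    rw [← Functor.map_comp, ← CategoryTheory.Functor.map_id, ← Functor.map_sub,
      ← E.aug_unt_add_ret_inc Y, add_sub_cancel_left]
  rw [Category.assoc, ← Category.assoc (E.l.map _), ← Functor.map_comp, h, Preadditive.sub_comp,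
    Category.assoc, h0]
  simpa using ht

lemma exists_retract_G {X : A} (h : ∃ Y, Nonempty (Retract X (E.l.obj Y))) :
    ∃ Y, Nonempty (Retract (E.G.obj X) (E.l.obj Y)) := by
  obtain ⟨Y, ⟨r⟩⟩ := h
  obtain ⟨r'⟩ := E.exists_retract_G_l Y
  exact ⟨E.F.obj Y, ⟨(r.map E.G).trans r'⟩⟩

lemma exists_retract_iter_G {X : A} (h : ∃ Y, Nonempty (Retract X (E.l.obj Y))) (k : ℕ) :
    ∃ Y, Nonempty (Retract ((iter E.G k).obj X) (E.l.obj Y)) := by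
  induction k with
  | zero => exact h
  | succ k ih => exact E.exists_retract_G ih

lemma exists_retract_of_projective (X : A) [Projective X] :
    ∃ Y, Nonempty (Retract X (E.l.obj Y)) :=
  ⟨E.e.obj X, ⟨⟨Projective.factorThru (𝟙 X) (E.cou X), E.cou X, Projective.factorThru_comp _ _⟩⟩⟩

/-- If the terms of `M` are retracts of objects `l(Y)` and `e(M)` and `qG(M)` are acyclic, then
`q(M)` is acyclic. -/
lemma acyclic_q_of_acyclic_q_G (M : CochainComplex A ℤ)
    (hM : ∀ n, ∃ Y, Nonempty (Retract (M.X n) (E.l.obj Y)))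
    (he : ((E.e.mapHomologicalComplex _).obj M).Acyclic)
    (hG : (((E.G ⋙ E.q).mapHomologicalComplex _).obj M).Acyclic) :
    ((E.q.mapHomologicalComplex _).obj M).Acyclic := by
  let f : ((E.G ⋙ E.q).mapHomologicalComplex (ComplexShape.up ℤ)).obj M ⟶
      (((E.e ⋙ E.l) ⋙ E.q).mapHomologicalComplex _).obj M :=
    (NatTrans.mapHomologicalComplex (Functor.whiskerRight E.u E.q) _).app M
  let g : (((E.e ⋙ E.l) ⋙ E.q).mapHomologicalComplex (ComplexShape.up ℤ)).obj M ⟶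
      ((𝟭 A ⋙ E.q).mapHomologicalComplex _).obj M :=
    (NatTrans.mapHomologicalComplex (Functor.whiskerRight E.adj.counit E.q) _).app M
  have w (n : ℤ) : E.q.map (E.inG (M.X n)) ≫ E.q.map (E.cou (M.X n)) = 0 := by
    rw [← Functor.map_comp, inG_cou, Functor.map_zero]
  have hfg : f ≫ g = 0 := HomologicalComplex.hom_ext _ _ fun n => w n
  have hS : (ShortComplex.mk f g hfg).ShortExact := by
    apply HomologicalComplex.shortExact_of_degreewise_shortExact
    intro n
    obtain ⟨Y, ⟨r⟩⟩ := hM n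
    have h : (ShortComplex.mk (E.q.map (E.inG (M.X n))) (E.q.map (E.cou (M.X n)))
        (w n)).ShortExact :=
      { exact := map_exact_of_epi E.q (E.exact_inG_cou (M.X n))
        mono_f := E.mono_q_inG_of_retract r
        epi_g := inferInstanceAs (Epi (E.q.map (E.cou (M.X n)))) }
    exact h
  have h₂ : ((((E.e ⋙ E.l) ⋙ E.q).mapHomologicalComplex _).obj M).Acyclic :=
    acyclic_of_natIso (Functor.isoWhiskerLeft E.e E.qlIso).symm he
  exact acyclic_X₃ hS hG h₂

lemma isZero_of_isZero_e {X : A} (h : IsZero (E.e.obj X)) : IsZero X := by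
  rw [IsZero.iff_id_eq_zero]
  exact E.e.map_injective (h.eq_of_src _ _)

lemma isZero_iter_G {s : ℕ} (hs : ∀ Y : B, IsZero ((iter E.F s).obj Y)) (X : A) :
    IsZero ((iter E.G s).obj X) :=
  E.isZero_of_isZero_e ((hs (E.e.obj X)).of_iso ((iterIso E.eGNatIso s).app X))

lemma CompatibleQ'.compatibleQ {E : CleftExtension B A} (h : E.CompatibleQ') : E.CompatibleQ := by
  obtain ⟨⟨s, hs⟩, -, h⟩ := h
  intro Q hQ
  constructor
  -- Descending induction on `k`, starting from `Gˢ = 0`: acyclicity of `qGᵏ⁺¹(Q)` and of `eGᵏ(Q) ≅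
  -- Fᵏe(Q)` gives that of `qGᵏ(Q)`. For `k = 0` the second complex is `e(Q)`, acyclic since `e` is
  -- exact.
  · have key : ∀ m k : ℕ, k + m = s →
        ((E.q.mapHomologicalComplex _).obj (((iter E.G k).mapHomologicalComplex _).obj Q)).Acyclic
        := by
      intro m
      induction m with
      | zero =>
        rintro k rfl n
        exact .of_isZero (Functor.map_isZero E.q (E.isZero_iter_G hs (Q.X n)))
      | succ m ih =>
        intro k hk
        apply E.acyclic_q_of_acyclic_q_G
        · intro n
          have := hQ.projective n
          exact E.exists_retract_iter_G (E.exists_retract_of_projective (Q.X n)) k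
        · have hk : (((E.e ⋙ iter E.F k).mapHomologicalComplex _).obj Q).Acyclic := by
            rcases Nat.eq_zero_or_pos k with rfl | hk
            · exact acyclic_map_of_exact E.e hQ.acyclic
            · exact (h Q hQ k hk).1
          exact acyclic_of_natIso (iterIso E.eGNatIso k).symm hk
        · exact ih (k + 1) (by lia)
    exact key s 0 (by lia)
  · intro P hP
    -- The same shift on the `Hom` side, with middle term `leGᵏi(P) ≅ lFᵏ(P)`, which is projective
    -- when `k = 0`.
    have key : ∀ m k : ℕ, k + m = s → HomAcyclic Q ((iter E.G k).obj (E.i.obj P)) := by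
      intro m
      induction m with
      | zero =>
        rintro k rfl n f -
        exact ⟨0, (E.isZero_iter_G hs _).eq_of_tgt _ _⟩
      | succ m ih =>
        intro k hk
        refine HomAcyclic.of_exact hQ.projective (E.exact_inG_cou _) (ih (k + 1) (by lia)) ?_
        have hk : HomAcyclic Q (E.l.obj ((iter E.F k).obj P)) := by
          rcases Nat.eq_zero_or_pos k with rfl | hk
          · exact hQ.hom_acyclic _ (inferInstanceAs (Projective (E.l.obj P)))
          · exact (h Q hQ k hk).2 P hP
        exact hk.of_iso (E.l.mapIso ((iter E.F k).mapIso (E.ei.symm.app P) ≪≫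
          (iterIso E.eGNatIso k).symm.app (E.i.obj P)))
    exact key s 0 (by lia)

lemma IsCompatible.compatibleQ {E : CleftExtension B A} (h : E.IsCompatible) : E.CompatibleQ :=
  h.2.elim id CompatibleQ'.compatibleQ

/-- The functor `q` preserves complete projective resolutions. -/
lemma CompatibleQ.map_q {E : CleftExtension B A} (h : E.CompatibleQ) {Q : CochainComplex A ℤ}
    (hQ : IsCompleteProjectiveResolution Q) :
    IsCompleteProjectiveResolution ((E.q.mapHomologicalComplex _).obj Q) where
  acyclic := (h Q hQ).1
  projective n :=
    haveI := hQ.projective n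
    inferInstanceAs (Projective (E.q.obj (Q.X n)))
  hom_acyclic P hP n f hf := by
    change E.q.obj (Q.X n) ⟶ P at f
    change E.q.map (Q.d (n - 1) n) ≫ f = 0 at hf
    obtain ⟨g, hg⟩ := (h Q hQ).2 P hP n (E.qAdj.homEquiv _ _ f) (by
      rw [← Adjunction.homEquiv_naturality_left, hf]
      simp [Adjunction.homEquiv_unit])
    refine ⟨(E.qAdj.homEquiv _ _).symm g, ?_⟩
    change E.q.map (Q.d n (n + 1)) ≫ _ = _
    rw [← Adjunction.homEquiv_naturality_left_symm, hg, Equiv.symm_apply_apply]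

lemma CompatibleQ.isGorensteinProjective_q {E : CleftExtension B A} (h : E.CompatibleQ) {X : A}
    (hX : IsGorensteinProjective X) :
    IsGorensteinProjective (E.q.obj X) ∧ Mono (E.q.map (E.inG X)) := by
  obtain ⟨Q, hQ, p, m, _, _, hpm⟩ := (isGorensteinProjective_iff X).1 hX
  have hq := h.map_q hQ
  have hp : Q.d (-1) 0 ≫ p = 0 := by
    rw [← cancel_mono m, Category.assoc, hpm]
    simp
  constructor
  · rw [isGorensteinProjective_iff]
    have hm : Mono (E.q.map m) :=
      map_mono_of_exact E.q (exact_map_of_acyclic hq.acyclic (-1) 0 1 rfl rfl) hp hpm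
    have he : Epi (E.q.map p) := inferInstance
    exact ⟨_, hq, E.q.map p, E.q.map m, he, hm, (E.q.map_comp p m).symm.trans (congrArg _ hpm)⟩
  -- `Q⁻¹` maps onto the kernel of `p`, so acyclicity of `q(Q)` one degree lower makes `q` of the
  -- kernel inclusion monic.
  · have ex₀ := exact_of_acyclic hQ.acyclic (-1) 0 1 rfl rfl
    let k : Q.X (-1) ⟶ kernel p := kernel.lift p _ hp
    have hk : k ≫ kernel.ι p = Q.d (-1) 0 := kernel.lift_ι _ _ _
    have : Epi k := by
      rw [epi_iff_surjective_up_to_refinements]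
      intro T y
      obtain ⟨T', π, hπ, x, hx⟩ := ex₀.exact_up_to_refinements (y ≫ kernel.ι p) (by
        change (y ≫ kernel.ι p) ≫ Q.d 0 1 = 0
        rw [← hpm, Category.assoc, kernel.condition_assoc, zero_comp, comp_zero])
      refine ⟨T', π, hπ, x, ?_⟩
      rw [← cancel_mono (kernel.ι p), Category.assoc, hx, Category.assoc, hk]
    have : Mono (E.q.map (kernel.ι p)) :=
      map_mono_of_exact E.q (exact_map_of_acyclic hq.acyclic (-2) (-1) 0 rfl rfl)
        (by rw [← cancel_mono (kernel.ι p), Category.assoc, hk]; simp) hk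
    have := hQ.projective 0
    exact map_mono_of_projective E.q (ShortComplex.exact_kernel p) (E.exact_inG_cou X)

/-! ### Nakayama's lemma and projectives of `A` when `η = 0`. -/

variable {E}

/-- If the cokernel `q(X)` of the action vanishes, `act` is epic, and so is `F(act)`. But `F(act) ≫
act` factors through `η = 0`, so `act` is both zero and epic. -/
lemma isZero_of_isZero_q (hE : ∀ Y, E.mulF Y = 0) {X : A} (h : IsZero (E.q.obj X)) :
    IsZero X := by
  apply E.isZero_of_isZero_e
  have : Epi (E.act X) := by
    rw [Preadditive.epi_iff_cancel_zero]
    intro W w hw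
    obtain ⟨g, rfl⟩ := E.toQ_desc w hw
    rw [h.eq_of_src g 0, comp_zero]
  have h0 : E.act X = 0 := by
    rw [← cancel_epi (E.F.map (E.act X)), map_act_act, hE, zero_comp, comp_zero]
  rw [IsZero.iff_id_eq_zero, ← cancel_epi (E.act X), h0, zero_comp, zero_comp]

lemma epi_of_epi_q (hE : ∀ Y, E.mulF Y = 0) {X Z : A} (f : X ⟶ Z) [Epi (E.q.map f)] : Epi f := by
  have h0 : E.q.map (cokernel.π f) = 0 := by
    rw [← cancel_epi (E.q.map f), ← Functor.map_comp, cokernel.condition, Functor.map_zero,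
      comp_zero]
  have hz : IsZero (cokernel f) := by
    apply isZero_of_isZero_q hE
    rw [IsZero.iff_id_eq_zero, ← cancel_epi (E.q.map (cokernel.π f)), h0, zero_comp, zero_comp]
  exact Preadditive.epi_of_cokernel_zero (hz.eq_of_tgt _ _)

instance (X : A) : Epi (E.unq X) := by
  apply E.e.epi_of_epi_map
  have h : E.e.map (E.unq X) = E.toQ X ≫ E.eiInv _ := by
    rw [toQ, Category.assoc, ei_hom_inv, Category.comp_id]
  rw [h]
  infer_instance

/-- Lifting `l(q(R)) ⟶ iq(R)` through `R ⟶ iq(R)` gives a map that is epic after `q`, hence epic,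
hence split by projectivity of `R`. -/
lemma nonempty_retract_l_q (hE : ∀ Y, E.mulF Y = 0) (R : A) [Projective R] :
    Nonempty (Retract R (E.l.obj (E.q.obj R))) := by
  let h : E.l.obj (E.q.obj R) ⟶ R := Projective.factorThru (E.toI (E.q.obj R)) (E.unq R)
  have hh : h ≫ E.unq R = E.toI (E.q.obj R) := Projective.factorThru_comp _ _
  have key : E.toQ _ ≫ E.q.map h = E.aug (E.q.obj R) := by
    rw [← toQ_nat, toQ, ← Category.assoc, ← Functor.map_comp, hh, map_toI]
  have : Epi (E.aug (E.q.obj R)) := epi_of_epi_fac (E.unt_aug _)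
  have : Epi (E.q.map h) := epi_of_epi_fac key
  have : Epi h := epi_of_epi_q hE h
  exact ⟨⟨Projective.factorThru (𝟙 R) h, h, Projective.factorThru_comp _ _⟩⟩

/-! ### Morphisms between free objects and twisted complexes. -/

variable (E) in
/-- The morphism `l(Y) ⟶ l(Z)` with components `Y ⟶ Z` and `Y ⟶ F(Z)`. -/
def twist {Y Z : B} (f : Y ⟶ Z) (t : Y ⟶ E.F.obj Z) : E.l.obj Y ⟶ E.l.obj Z :=
  E.ext (f ≫ E.unt Z + t ≫ E.inc Z)

lemma unt_twist {Y Z : B} (f : Y ⟶ Z) (t : Y ⟶ E.F.obj Z) :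
    E.unt Y ≫ E.e.map (E.twist f t) = f ≫ E.unt Z + t ≫ E.inc Z := E.unt_ext _

lemma inc_twist (hE : ∀ Y, E.mulF Y = 0) {Y Z : B} (f : Y ⟶ Z) (t : Y ⟶ E.F.obj Z) :
    E.inc Y ≫ E.e.map (E.twist f t) = E.F.map f ≫ E.inc Z := by
  rw [twist, inc_ext, Functor.map_add, Functor.map_comp, Functor.map_comp, Preadditive.add_comp,
    Category.assoc, Category.assoc, map_unt_act, map_inc_act, hE, zero_comp, comp_zero, add_zero]

/-- In general the second component would also contain `t ≫ F(s) ≫ η`. Without it, the differentials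
`(d, t)` square to zero exactly under the cocycle condition on `t`. -/
lemma twist_comp (hE : ∀ Y, E.mulF Y = 0) {Y Z W : B} (f : Y ⟶ Z) (t : Y ⟶ E.F.obj Z)
    (g : Z ⟶ W) (s : Z ⟶ E.F.obj W) :
    E.twist f t ≫ E.twist g s = E.twist (f ≫ g) (f ≫ s + t ≫ E.F.map g) := by
  apply E.hom_ext
  rw [Functor.map_comp, ← Category.assoc, unt_twist, Preadditive.add_comp, Category.assoc,
    Category.assoc, unt_twist, inc_twist hE, unt_twist]
  simp only [Preadditive.comp_add, Preadditive.add_comp, Category.assoc]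
  abel

lemma exists_twist {Y Z : B} (k : E.l.obj Y ⟶ E.l.obj Z) :
    ∃ (f : Y ⟶ Z) (t : Y ⟶ E.F.obj Z), k = E.twist f t := by
  refine ⟨(E.unt Y ≫ E.e.map k) ≫ E.aug Z, (E.unt Y ≫ E.e.map k) ≫ E.ret Z, E.hom_ext ?_⟩
  rw [unt_twist, ← decomp]

lemma twist_eq_zero {Y Z : B} {f : Y ⟶ Z} {t : Y ⟶ E.F.obj Z} (h : E.twist f t = 0) :
    f = 0 ∧ t = 0 := by
  have h' := E.unt_twist f t
  rw [h, Functor.map_zero, comp_zero] at h'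
  constructor
  · simpa using (h' =≫ E.aug Z).symm
  · simpa using (h' =≫ E.ret Z).symm

lemma twist_zero (Y Z : B) : E.twist (0 : Y ⟶ Z) 0 = 0 :=
  E.hom_ext (by rw [unt_twist]; simp)

/-- The complex with terms `l(Pⁿ)` and differentials given by those of `P` and a cocycle
`Pⁿ ⟶ F(Pⁿ⁺¹)`. -/
def twistComplex (hE : ∀ Y, E.mulF Y = 0) (P : CochainComplex B ℤ)
    (t : ∀ n : ℤ, P.X n ⟶ E.F.obj (P.X (n + 1)))
    (ht : ∀ n : ℤ, P.d n (n + 1) ≫ t (n + 1) + t n ≫ E.F.map (P.d (n + 1) (n + 1 + 1)) = 0) :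
    CochainComplex A ℤ :=
  CochainComplex.of (fun n => E.l.obj (P.X n)) (fun n => E.twist (P.d n (n + 1)) (t n))
    (fun n => by rw [twist_comp hE, ht, P.d_comp_d, twist_zero])

section TwistComplex

variable (hE : ∀ Y, E.mulF Y = 0) (P : CochainComplex B ℤ)
    (t : ∀ n : ℤ, P.X n ⟶ E.F.obj (P.X (n + 1)))
    (ht : ∀ n : ℤ, P.d n (n + 1) ≫ t (n + 1) + t n ≫ E.F.map (P.d (n + 1) (n + 1 + 1)) = 0)

lemma twistComplex_d (n : ℤ) : (twistComplex hE P t ht).d n (n + 1) =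
    E.twist (P.d n (n + 1)) (t n) :=
  CochainComplex.of_d (fun n => E.l.obj (P.X n)) (fun n => E.twist (P.d n (n + 1)) (t n)) n

lemma twistComplex_acyclic (hP : P.Acyclic)
    (hF : ((E.F.mapHomologicalComplex _).obj P).Acyclic) : (twistComplex hE P t ht).Acyclic := by
  apply acyclic_of_exact_succ
  intro n
  have w : E.twist (P.d n (n + 1)) (t n) ≫ E.twist (P.d (n + 1) (n + 1 + 1)) (t (n + 1)) = 0 := by
    rw [twist_comp hE, ht, P.d_comp_d, twist_zero]
  suffices h : (ShortComplex.mk _ _ w).Exact from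
    exact_congr h (twistComplex_d hE P t ht n) (twistComplex_d hE P t ht (n + 1))
  apply E.e.reflects_exact_of_faithful
  rw [ShortComplex.exact_iff_exact_up_to_refinements]
  intro T y hy
  change T ⟶ E.e.obj (E.l.obj (P.X (n + 1))) at y
  change y ≫ E.e.map (E.twist (P.d (n + 1) (n + 1 + 1)) (t (n + 1))) = 0 at hy
  obtain ⟨y₀, y₁, rfl⟩ : ∃ y₀ y₁, y = y₀ ≫ E.unt _ + y₁ ≫ E.inc _ := ⟨_, _, E.decomp y⟩
  rw [Preadditive.add_comp, Category.assoc, Category.assoc, unt_twist, inc_twist hE] at hy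
  have hy₀ : y₀ ≫ P.d (n + 1) (n + 1 + 1) = 0 := by simpa using hy =≫ E.aug _
  have hy₁ : y₀ ≫ t (n + 1) + y₁ ≫ E.F.map (P.d (n + 1) (n + 1 + 1)) = 0 := by
    simpa using hy =≫ E.ret _
  obtain ⟨T₁, π₁, _, w₀, h₀⟩ :=
    (exact_of_acyclic hP n (n + 1) (n + 1 + 1) rfl rfl).exact_up_to_refinements y₀ hy₀
  change T₁ ⟶ P.X n at w₀
  dsimp only at h₀
  obtain ⟨T₂, π₂, _, w₁, h₁⟩ :=
    (exact_map_of_acyclic hF n (n + 1) (n + 1 + 1) rfl rfl).exact_up_to_refinements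
      -- Once `y₀` is lifted to `w₀` along `P`, the twist contributes `w₀ ≫ t n` to the
      -- `F`-component; the difference is a cycle of `F(P)` by the cocycle condition.
      (π₁ ≫ y₁ - w₀ ≫ t n) (by
        have h2 := π₁ ≫= hy₁
        have h3 := w₀ ≫= ht n
        simp only [Preadditive.comp_add, comp_zero, reassoc_of% h₀] at h2 h3
        rw [Preadditive.sub_comp, Category.assoc, Category.assoc, ← sub_eq_zero.2 (h2.trans h3.symm)]
        abel)
  change T₂ ⟶ E.F.obj (P.X n) at w₁
  dsimp only at h₁
  refine ⟨T₂, π₂ ≫ π₁, inferInstance, π₂ ≫ w₀ ≫ E.unt _ + w₁ ≫ E.inc _, ?_⟩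
  change (π₂ ≫ π₁) ≫ (y₀ ≫ E.unt _ + y₁ ≫ E.inc _) = (π₂ ≫ w₀ ≫ E.unt _ + w₁ ≫ E.inc _) ≫
    E.e.map (E.twist (P.d n (n + 1)) (t n))
  rw [Preadditive.add_comp, Category.assoc, Category.assoc, Category.assoc, Category.assoc,
    unt_twist, inc_twist hE, ← Category.assoc w₁, ← h₁]
  simp only [Preadditive.comp_add, Preadditive.sub_comp, Preadditive.comp_sub, Category.assoc,
    reassoc_of% h₀]
  abel

lemma twistComplex_homAcyclic {R : B} (hR : HomAcyclic P R) (hF : HomAcyclic P (E.F.obj R)) :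
    HomAcyclic (twistComplex hE P t ht) (E.l.obj R) := by
  apply homAcyclic_of_succ
  intro n f hf
  rw [twistComplex_d] at hf ⊢
  change E.l.obj (P.X (n + 1)) ⟶ E.l.obj R at f
  obtain ⟨f₀, f₁, rfl⟩ := exists_twist f
  obtain ⟨h₀, h₁⟩ := twist_eq_zero ((twist_comp hE _ _ _ _).symm.trans hf)
  obtain ⟨g₀, hg₀⟩ := hR.exists_extension n (n + 1) (n + 1 + 1) rfl rfl f₀ h₀
  obtain ⟨g₁, hg₁⟩ := hF.exists_extension n (n + 1) (n + 1 + 1) rfl rfl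
    (f₁ - t (n + 1) ≫ E.F.map g₀) (by
      have h := ht n =≫ E.F.map g₀
      rw [Preadditive.add_comp, Category.assoc, Category.assoc, ← Functor.map_comp, hg₀,
        zero_comp] at h
      rw [Preadditive.comp_sub, ← sub_eq_zero.2 (h₁.trans h.symm)]
      abel)
  refine ⟨E.twist g₀ g₁, ?_⟩
  refine (twist_comp hE _ _ _ _).trans ?_
  rw [hg₀, hg₁, sub_add_cancel]

lemma twistComplex_isCompleteProjectiveResolution (hL : E.CompatibleL)
    (hP : IsCompleteProjectiveResolution P) :
    IsCompleteProjectiveResolution (twistComplex hE P t ht) where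
  acyclic := twistComplex_acyclic hE P t ht hP.acyclic (hL P hP).1
  projective n :=
    haveI := hP.projective n
    inferInstanceAs (Projective (E.l.obj (P.X n)))
  hom_acyclic R hR := by
    obtain ⟨r⟩ := nonempty_retract_l_q hE R
    have : Projective (E.q.obj R) := inferInstance
    exact (twistComplex_homAcyclic hE P t ht (hP.hom_acyclic _ this)
      ((hL P hP).2 _ this)).of_retract r.i r.r r.retract

end TwistComplex

/-! ### The implication (3) ⇒ (1) when `η = 0`. -/

lemma isGorensteinProjective_of_q (hE : ∀ Y, E.mulF Y = 0) (hL : E.CompatibleL) {X : A}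
    (hX : IsGorensteinProjective (E.q.obj X))
    (hex : (ShortComplex.mk (E.alpha X) (E.beta X) (E.alpha_beta X)).Exact) :
    IsGorensteinProjective X := by
  obtain ⟨P, hP, p, m, _, _, hpm⟩ := (isGorensteinProjective_iff _).1 hX
  have hproj := hP.projective
  obtain ⟨hFP, hPF⟩ := hL P hP
  have wact : E.F.map (E.act X) ≫ E.act X = 0 := by rw [map_act_act, hE, zero_comp]
  have exact_act : (ShortComplex.mk (E.F.map (E.act X)) (E.act X) wact).Exact := by
    rw [ShortComplex.exact_iff_exact_up_to_refinements] at hex ⊢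
    intro T y hy
    obtain ⟨T', π, hπ, x, hx⟩ := hex y (by
      change y ≫ E.beta X = 0
      rw [beta_eq, Preadditive.comp_neg, neg_eq_zero]
      exact hy)
    have ha : E.alpha X = E.F.map (E.act X) := by rw [alpha_eq, hE, sub_zero]
    exact ⟨T', π, hπ, x, hx.trans (congrArg (x ≫ ·) ha)⟩
  have exFQ := map_exact_of_epi E.F (E.exact_act_toQ X)
  -- the inclusion of `F(q(X))` in `e(X)`
  obtain ⟨j, hj⟩ : ∃ j : E.F.obj (E.q.obj X) ⟶ E.e.obj X, E.F.map (E.toQ X) ≫ j = E.act X :=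
    haveI : Epi (ShortComplex.mk (E.F.map (E.act X)) (E.F.map (E.toQ X))
      (by rw [← Functor.map_comp, act_toQ, Functor.map_zero])).g :=
        inferInstanceAs (Epi (E.F.map (E.toQ X)))
    ⟨exFQ.desc (E.act X) wact, exFQ.g_desc _ _⟩
  have : Mono j := mono_of_exact_of_fac exact_act (E.F.map (E.toQ X)) j
    (by rw [← Functor.map_comp, act_toQ, Functor.map_zero]) hj
  have wj : j ≫ E.toQ X = 0 := by
    rw [← cancel_epi (E.F.map (E.toQ X)), ← Category.assoc, hj, act_toQ, comp_zero]
  have exj : (ShortComplex.mk j (E.toQ X) wj).Exact := by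
    rw [ShortComplex.exact_iff_exact_up_to_refinements]
    intro T y hy
    obtain ⟨T', π, hπ, x, hx⟩ := (E.exact_act_toQ X).exact_up_to_refinements y hy
    refine ⟨T', π, hπ, x ≫ E.F.map (E.toQ X), ?_⟩
    dsimp only at hx ⊢
    rw [hx, Category.assoc, hj]
  have hdp : P.d (-1) 0 ≫ p = 0 := by
    rw [← cancel_mono m, Category.assoc, hpm]
    simp
  have hmd : m ≫ P.d 1 2 = 0 := by
    rw [← cancel_epi p, ← Category.assoc, hpm]
    simp
  have exp : (ShortComplex.mk (P.d (-1) 0) p hdp).Exact := by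
    have h := exact_of_acyclic hP.acyclic (-1) 0 1 rfl rfl
    rw [ShortComplex.exact_iff_exact_up_to_refinements] at h ⊢
    intro T y hy
    exact h y (by
      change y ≫ P.d 0 1 = 0
      rw [← hpm, ← Category.assoc]
      exact (hy =≫ m).trans zero_comp)
  -- a lift of `p` to `e(X)` and its restriction to the cycles
  obtain ⟨σ, hσ⟩ : ∃ σ : P.X 0 ⟶ E.e.obj X, σ ≫ E.toQ X = p :=
    ⟨Projective.factorThru p (E.toQ X), Projective.factorThru_comp _ _⟩
  obtain ⟨c, hc⟩ : ∃ c : P.X (-1) ⟶ E.F.obj (E.q.obj X), c ≫ j = P.d (-1) 0 ≫ σ :=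
    haveI : Mono (ShortComplex.mk j (E.toQ X) wj).f := ‹Mono j›
    have h : (P.d (-1) 0 ≫ σ) ≫ E.toQ X = 0 := by rw [Category.assoc, hσ, hdp]
    ⟨exj.lift _ h, exj.lift_f _ h⟩
  -- `c` measures the failure of `σ` to kill the boundaries. Pushed into `F(P¹)` it is a cocycle, so
  -- acyclicity of `Hom(P, F(P¹))` extends it to `P⁰`.
  obtain ⟨t₀, ht₀⟩ := (hPF _ (hproj 1)).exists_extension (-2) (-1) 0 rfl rfl (c ≫ E.F.map m) (by
    have : P.d (-2) (-1) ≫ c = 0 := by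
      rw [← cancel_mono j, Category.assoc, hc]
      simp
    rw [← Category.assoc, this, zero_comp])
  -- the extension of `F(m)` to `e(X)`
  obtain ⟨g, hσg, hjg⟩ : ∃ g : E.e.obj X ⟶ E.F.obj (P.X 1), σ ≫ g = t₀ ∧ j ≫ g = E.F.map m := by
    -- `e(X)` is the quotient of `P⁰ ⊕ Fq(X)` by the image of `P⁻¹` under `(d, -c)`, so `g` exists
    -- because `t₀` and `F(m)` agree on `P⁻¹`, which is `ht₀`.
    have hepi : Epi (biprod.desc σ j) := by
      rw [epi_iff_surjective_up_to_refinements]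
      intro T y
      obtain ⟨T₁, π₁, _, y₁, h₁⟩ := surjective_up_to_refinements_of_epi p (y ≫ E.toQ X)
      have h : (π₁ ≫ y - y₁ ≫ σ) ≫ E.toQ X = 0 := by
        rw [Preadditive.sub_comp, Category.assoc, Category.assoc, h₁, hσ, sub_self]
      obtain ⟨T₂, π₂, _, y₂, h₂⟩ := exj.exact_up_to_refinements _ h
      dsimp only at h₂
      refine ⟨T₂, π₂ ≫ π₁, inferInstance, biprod.lift (π₂ ≫ y₁) y₂, ?_⟩
      rw [biprod.lift_desc, ← h₂, Preadditive.comp_sub, Category.assoc, Category.assoc]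
      abel
    have hker : kernel.ι (biprod.desc σ j) ≫ biprod.desc t₀ (E.F.map m) = 0 := by
      have hk : (kernel.ι (biprod.desc σ j) ≫ biprod.fst) ≫ σ +
          (kernel.ι (biprod.desc σ j) ≫ biprod.snd) ≫ j = 0 := by
        rw [Category.assoc, Category.assoc, ← Preadditive.comp_add, ← biprod.desc_eq,
          kernel.condition]
      have hx : (kernel.ι (biprod.desc σ j) ≫ biprod.fst) ≫ p = 0 := by
        have := hk =≫ E.toQ X
        rwa [Preadditive.add_comp, Category.assoc, Category.assoc _ j, hσ, wj, comp_zero, add_zero,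
          zero_comp] at this
      have hd : biprod.desc t₀ (E.F.map m) = biprod.fst ≫ t₀ + biprod.snd ≫ E.F.map m :=
        biprod.desc_eq
      rw [hd, Preadditive.comp_add, ← Category.assoc, ← Category.assoc]
      generalize kernel.ι (biprod.desc σ j) ≫ biprod.fst = x at hk hx
      generalize kernel.ι (biprod.desc σ j) ≫ biprod.snd = y at hk
      obtain ⟨T, π, _, x', h'⟩ := exp.exact_up_to_refinements x hx
      dsimp only at h'
      have hy : π ≫ y = -(x' ≫ c) := by
        rw [← cancel_mono j, Preadditive.neg_comp, Category.assoc, Category.assoc, hc,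
          ← reassoc_of% h', eq_neg_iff_add_eq_zero, add_comm, ← Preadditive.comp_add, hk, comp_zero]
      rw [← cancel_epi π, Preadditive.comp_add, reassoc_of% h', ht₀, ← Category.assoc π, hy,
        Preadditive.neg_comp, Category.assoc, add_neg_cancel, comp_zero]
    obtain ⟨g, hg⟩ : ∃ g, biprod.desc σ j ≫ g = biprod.desc t₀ (E.F.map m) :=
      ⟨_, Abelian.comp_epiDesc _ _ hker⟩
    refine ⟨g, ?_, ?_⟩
    · simpa using biprod.inl ≫= hg
    · simpa using biprod.inr ≫= hg
  have hFm : Mono (E.F.map m) :=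
    map_mono_of_exact E.F (exact_map_of_acyclic hFP (-1) 0 1 rfl rfl) hdp hpm
  obtain ⟨t, ht0, ht⟩ := exists_cocycle_extension hproj hFP
    (fun n => (hPF _ (hproj n))) 0 t₀ (by
      change P.d (-1) 0 ≫ t₀ ≫ E.F.map (P.d 1 2) = 0
      rw [reassoc_of% ht₀, ← Functor.map_comp, hmd, Functor.map_zero, comp_zero])
  -- The map with components `toQ ≫ m` and `g` respects the actions: on `Fe(X)` both sides reduce to
  -- `F(toQ ≫ m)` followed by `inc`, using `j ≫ g = F(m)` and `η = 0`.
  obtain ⟨m', hm'⟩ : ∃ m' : X ⟶ E.l.obj (P.X 1),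
      E.e.map m' = E.toQ X ≫ m ≫ E.unt _ + g ≫ E.inc _ := by
    apply E.exists_lift
    rw [Functor.map_add, Preadditive.add_comp, Functor.map_comp, Functor.map_comp, Functor.map_comp,
      Category.assoc, Category.assoc, Category.assoc, map_unt_act, map_inc_act, hE, zero_comp,
      comp_zero, add_zero, Preadditive.comp_add, reassoc_of% E.act_toQ X, zero_comp, zero_add,
      ← hj, Category.assoc, reassoc_of% hjg]
  -- After `q` this map dominates the epimorphism `p`, so Nakayama applies.
  have hepi : Epi (E.ext σ) := by
    have h1 : E.unt _ ≫ E.toQ _ ≫ E.q.map (E.ext σ) = p := by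
      rw [← toQ_nat, ← Category.assoc, unt_ext, hσ]
    rw [← Category.assoc] at h1
    have : Epi (E.q.map (E.ext σ)) := epi_of_epi_fac h1
    exact epi_of_epi_q hE _
  -- An element killed by `m'` dies in `q(X)` since `m` is monic, hence comes from `Fq(X)`, where
  -- `g` restricts to the monomorphism `F(m)`.
  have hmono : Mono m' := by
    apply E.e.mono_of_mono_map
    rw [Preadditive.mono_iff_cancel_zero]
    intro T y hy
    rw [hm', Preadditive.comp_add] at hy
    have h0 : y ≫ E.toQ X = 0 := by
      rw [← cancel_mono m]
      simpa using hy =≫ E.aug _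
    have h1 : y ≫ g = 0 := by simpa using hy =≫ E.ret _
    obtain ⟨z, rfl⟩ : ∃ z, z ≫ j = y :=
      haveI : Mono (ShortComplex.mk j (E.toQ X) wj).f := ‹Mono j›
      ⟨exj.lift y h0, exj.lift_f y h0⟩
    rw [Category.assoc, hjg] at h1
    rw [(cancel_mono (E.F.map m)).1 (h1.trans zero_comp.symm), zero_comp]
  have hcomp : E.ext σ ≫ m' = E.twist (P.d 0 1) t₀ := by
    rw [ext_comp, hm', Preadditive.comp_add, reassoc_of% hσ, reassoc_of% hpm, reassoc_of% hσg,
      twist]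
  rw [isGorensteinProjective_iff]
  refine ⟨twistComplex hE P t ht, twistComplex_isCompleteProjectiveResolution hE P t ht hL hP,
    E.ext σ, m', hepi, hmono, hcomp.trans ?_⟩
  rw [← ht0]
  exact (twistComplex_d hE P t ht 0).symm

end CleftExtension

end

theorem theorem3p11 {B : Type u₁} [Category.{v₁} B] [Abelian B]
    {A : Type u₂} [Category.{v₂} A] [Abelian A]
    (E : CleftExtension B A) (hE : E.IsCompatible) (X : A) :
    (CleftExt.IsGorensteinProjective X →
      CleftExt.IsGorensteinProjective (E.q.obj X) ∧ Mono (E.q.map (E.u.app X))) ∧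
    ((CleftExt.IsGorensteinProjective (E.q.obj X) ∧ Mono (E.q.map (E.u.app X))) ↔
      (CleftExt.IsGorensteinProjective (E.q.obj X) ∧
        (ShortComplex.mk (E.alpha X) (E.beta X) (E.alpha_beta X)).Exact)) ∧
    (E.eta = 0 →
      List.TFAE [
        CleftExt.IsGorensteinProjective X,
        CleftExt.IsGorensteinProjective (E.q.obj X) ∧ Mono (E.q.map (E.u.app X)),
        CleftExt.IsGorensteinProjective (E.q.obj X) ∧
          (ShortComplex.mk (E.alpha X) (E.beta X) (E.alpha_beta X)).Exact]) := by
  have h23 : Mono (E.q.map (E.u.app X)) ↔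
      (ShortComplex.mk (E.alpha X) (E.beta X) (E.alpha_beta X)).Exact :=
    (E.exact_alpha_beta_iff X).symm
  refine ⟨hE.compatibleQ.isGorensteinProjective_q, and_congr_right fun _ => h23, fun h => ?_⟩
  have hη : ∀ Y, E.mulF Y = 0 := fun Y => (congrArg (fun k => k.app Y) h).trans rfl
  tfae_have 1 → 2 := hE.compatibleQ.isGorensteinProjective_q
  tfae_have 2 ↔ 3 := and_congr_right fun _ => h23
  tfae_have 3 → 1 := fun ⟨h₁, h₂⟩ =>
    CleftExtension.isGorensteinProjective_of_q hη hE.1 h₁ h₂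
  tfae_finish
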